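/- For a Young diagram $\mu$ and a finite-dimensional complex vector space $U$, let $S_\mu U$ be the Schur functor (the image of the Young symmetrizer of $\mu$ on $U^{\otimes|\mu|}$). For a strict partition $\lambda=(\lambda_1>\cdots>\lambda_\ell>0)$ let $d_+(\lambda)$ be the partition of $2|\lambda|$ with $\ell$ diagonal boxes whose $i$-th diagonal box has $\lambda_i$ boxes to its right and $\lambda_i-1$ boxes below it, and let $d_-(\lambda)$ be its conjugate. Partitions are ordered by inclusion of diagrams, and $\lambda^\vee$ denotes the conjugate of $\lambda$. Let $a\in\{1,2,4\}$, $n\ge 2$ and $k\ge1$. Define a complex vector space $L^k=L^k_{a,n}$ as follows. * $a=1$: $L^k=\bigoplus_\lambda S_{d_+(\lambda)}U$, with $\dim U=n+1$, over the strict partitions $\lambda$ of $k$ with $(1)\subseteq\lambda\subseteq(n+1)$. * $a=2$: $L^k=\bigoplus_\lambda S_\lambda U\otimes S_{\lambda^\vee}V$, with $\dim U=\dim V=n+1$, over the partitions $\lambda$ of $k$ with $(1)\subseteq\lambda\subseteq(n+1,1^n)$. * $a=4$: $L^k=\bigoplus_\lambda S_{d_-(\lambda)}U$, with $\dim U=2n+2$,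 over the strict partitions $\lambda$ of $k$ with $(1)\subseteq\lambda\subseteq(2n+1,2n)$. (These are the sums of the irreducible components of $\bigwedge^k(\mathrm{Sym}^2U)$, $\bigwedge^k(U\otimes V)$, $\bigwedge^k(\bigwedge^2U)$ respectively that are indexed by the partitions in the stated interval.) Put $f_k^{a,n}=\dim_{\mathbb C}L^{k+1}$. Then for all $a\in\{1,2,4\}$ and all $n\ge2$, $$\sum_{k=0}^{na}(-1)^k f_k^{a,n}=\begin{cases}\dfrac{1+(-1)^n}{2}&\text{if }a=1,\\[1ex] n+1&\text{if }a=2\text{ or }a=4.\end{cases}$$ -/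

import Mathlib

open scoped DirectSum TensorProduct

/-! ## Schur functors -/

/-- Permutations of the boxes of `μ` that preserve every row. -/
def rowGroup (μ : YoungDiagram) : Subgroup (Equiv.Perm μ.cells) where
  carrier := {σ | ∀ c, (σ c).1.1 = c.1.1}
  mul_mem' := fun {σ τ} hσ hτ c => (hσ (τ c)).trans (hτ c)
  one_mem' := fun _ => rfl
  inv_mem' := fun {σ} hσ c => by
    have h := hσ (σ⁻¹ c)
    rw [show σ (σ⁻¹ c) = c from σ.apply_symm_apply c] at h
    exact h.symm

/-- Permutations of the boxes of `μ` that preserve every column. -/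
def colGroup (μ : YoungDiagram) : Subgroup (Equiv.Perm μ.cells) where
  carrier := {σ | ∀ c, (σ c).1.2 = c.1.2}
  mul_mem' := fun {σ τ} hσ hτ c => (hσ (τ c)).trans (hτ c)
  one_mem' := fun _ => rfl
  inv_mem' := fun {σ} hσ c => by
    have h := hσ (σ⁻¹ c)
    rw [show σ (σ⁻¹ c) = c from σ.apply_symm_apply c] at h
    exact h.symm

/-- The tensor power `U^{⊗|μ|}`, with one tensor factor for each box of `μ`. -/
abbrev BoxTensor (μ : YoungDiagram) (U : Type) [AddCommGroup U] [Module ℂ U] : Type :=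
  PiTensorProduct ℂ (fun _ : μ.cells => U)

/-- A permutation of the boxes of `μ` permutes the factors of `U^{⊗|μ|}`. -/
noncomputable def permTensor (μ : YoungDiagram) (U : Type) [AddCommGroup U] [Module ℂ U]
    (σ : Equiv.Perm μ.cells) : BoxTensor μ U →ₗ[ℂ] BoxTensor μ U :=
  (PiTensorProduct.reindex ℂ (fun _ : μ.cells => U) σ).toLinearMap

open scoped Classical in
/-- Symmetrization along the rows of `μ`. -/
noncomputable def rowSymmetrizer (μ : YoungDiagram) (U : Type) [AddCommGroup U] [Module ℂ U] :
    BoxTensor μ U →ₗ[ℂ] BoxTensor μ U :=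
  ∑ σ : rowGroup μ, permTensor μ U σ.1

open scoped Classical in
/-- Antisymmetrization along the columns of `μ`. -/
noncomputable def colAntisymmetrizer (μ : YoungDiagram) (U : Type) [AddCommGroup U]
    [Module ℂ U] : BoxTensor μ U →ₗ[ℂ] BoxTensor μ U :=
  ∑ σ : colGroup μ, ((Equiv.Perm.sign σ.1 : ℤ) : ℂ) • permTensor μ U σ.1

/-- The Schur functor `S_μ U`: the image of the Young symmetrizer of `μ` on `U^{⊗|μ|}`.
It is the irreducible polynomial `GL(U)`-module of highest weight `μ`
(zero when `μ` has more than `dim U` rows). -/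
noncomputable def schurFunctor (μ : YoungDiagram) (U : Type) [AddCommGroup U] [Module ℂ U] :
    Submodule ℂ (BoxTensor μ U) :=
  LinearMap.range (rowSymmetrizer μ U ∘ₗ colAntisymmetrizer μ U)

/-! ## Strict partitions and their doubles -/

/-- The positive parts of `lam` (its nonzero row lengths) are strictly decreasing. -/
def IsStrictPartition (lam : YoungDiagram) : Prop :=
  ∀ i, 0 < lam.rowLen i → lam.rowLen (i + 1) < lam.rowLen i

/-- Row lengths of a strict partition drop by at least one at each step. -/
theorem IsStrictPartition.rowLen_add_le {lam : YoungDiagram} (h : IsStrictPartition lam)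
    (i d : ℕ) (hd : 0 < lam.rowLen (i + d)) : lam.rowLen (i + d) + d ≤ lam.rowLen i := by
  induction d with
  | zero => simp
  | succ d ih =>
    have h1 : lam.rowLen (i + (d + 1)) ≤ lam.rowLen (i + d) := lam.rowLen_anti _ _ (by omega)
    have h2 := h (i + d) (by omega)
    have h3 := ih (by omega)
    have h4 : i + (d + 1) = i + d + 1 := by omega
    rw [h4] at hd ⊢
    omega

/-- The boxes of the double of `lam`: the box `(i, m)` of `lam` (row `i`, column `m`, counted
from `0`) contributes the box `(i, i + m + 1)` to the right of the diagonal box `(i, i)` and the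
box `(i + m, i)` weakly below it. -/
def doubleCells (lam : YoungDiagram) : Finset (ℕ × ℕ) :=
  lam.cells.image (fun c => (c.1, c.1 + c.2 + 1)) ∪ lam.cells.image (fun c => (c.1 + c.2, c.1))

theorem mem_doubleCells {lam : YoungDiagram} (i j : ℕ) :
    (i, j) ∈ doubleCells lam ↔
      (i < j ∧ j ≤ i + lam.rowLen i) ∨ (j ≤ i ∧ i < j + lam.rowLen j) := by
  simp only [doubleCells, Finset.mem_union, Finset.mem_image, YoungDiagram.mem_cells,
    Prod.exists, Prod.mk.injEq]
  constructor
  · rintro (⟨p, m, hm, rfl, rfl⟩ | ⟨p, m, hm, rfl, rfl⟩)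
    · have := YoungDiagram.mem_iff_lt_rowLen.1 hm
      left; omega
    · have := YoungDiagram.mem_iff_lt_rowLen.1 hm
      right; omega
  · rintro (⟨h1, h2⟩ | ⟨h1, h2⟩)
    · exact Or.inl ⟨i, j - i - 1, YoungDiagram.mem_iff_lt_rowLen.2 (by omega), rfl, by omega⟩
    · exact Or.inr ⟨j, i - j, YoungDiagram.mem_iff_lt_rowLen.2 (by omega), by omega, rfl⟩

/-- The partition `d₊(λ)` of `2|λ|` attached to a strict partition `λ = (λ₁ > ⋯ > λ_ℓ > 0)`:
it has `ℓ` diagonal boxes, and the `i`-th one has `λᵢ` boxes to its right and `λᵢ - 1` boxes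
below it. -/
def dPlus (lam : YoungDiagram) (h : IsStrictPartition lam) : YoungDiagram where
  cells := doubleCells lam
  isLowerSet := by
    rintro ⟨i', j'⟩ ⟨i, j⟩ ⟨hi, hj⟩ hmem
    simp only [Finset.mem_coe, mem_doubleCells] at hmem ⊢
    simp only at hi hj
    rcases hmem with ⟨h1, h2⟩ | ⟨h1, h2⟩
    · have key : ∀ p, p ≤ i' → lam.rowLen i' + i' ≤ lam.rowLen p + p := by
        intro p hp
        have := h.rowLen_add_le p (i' - p) (by rw [Nat.add_sub_cancel' hp]; omega)
        rw [Nat.add_sub_cancel' hp] at this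
        omega
      rcases Nat.lt_or_ge i j with hij | hij
      · have := key i hi
        left; omega
      · have := key j (by omega)
        right; omega
    · have key : ∀ p, p ≤ j' → lam.rowLen j' + j' ≤ lam.rowLen p + p := by
        intro p hp
        have := h.rowLen_add_le p (j' - p) (by rw [Nat.add_sub_cancel' hp]; omega)
        rw [Nat.add_sub_cancel' hp] at this
        omega
      rcases Nat.lt_or_ge i j with hij | hij
      · have := key i (by omega)
        left; omega
      · have := key j (by omega)
        right; omega

/-- The partition `d₋(λ)`, conjugate to `d₊(λ)`. -/
def dMinus (lam : YoungDiagram) (h : IsStrictPartition lam) : YoungDiagram :=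
  (dPlus lam h).transpose

/-! ## The intervals `[s, t]` of partitions, ordered by inclusion -/

/-- The partition `(1)`, the bottom `s` of the interval. -/
def botPartition : YoungDiagram :=
  YoungDiagram.ofRowLens [1] (by simp [List.sortedGE_iff_pairwise])

/-- The partition `(n + 1)`, the top `t` of the interval over `ℝ`. -/
def topReal (n : ℕ) : YoungDiagram :=
  YoungDiagram.ofRowLens [n + 1] (by simp [List.sortedGE_iff_pairwise])

/-- The partition `(n + 1, 1, …, 1)` with `n` parts `1`, the top `t` of the interval over `ℂ`. -/
def topComplex (n : ℕ) : YoungDiagram :=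
  YoungDiagram.ofRowLens ((n + 1) :: List.replicate n 1) (by
    rw [List.sortedGE_iff_pairwise, List.pairwise_cons]
    refine ⟨fun b hb => ?_, ?_⟩
    · have := List.eq_of_mem_replicate hb
      omega
    · simp [List.pairwise_replicate])

/-- The partition `(2n + 1, 2n)`, the top `t` of the interval over the quaternions. -/
def topQuaternion (n : ℕ) : YoungDiagram :=
  YoungDiagram.ofRowLens [2 * n + 1, 2 * n] (by simp [List.sortedGE_iff_pairwise])

/-! ## The modules `L^k` and their dimensions -/

/-- Strict partitions of `k` in the interval `[s, t]`, over `ℝ`. -/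
def IndexReal (n k : ℕ) : Type :=
  {lam : {lam : YoungDiagram // IsStrictPartition lam} //
    botPartition ≤ lam.1 ∧ lam.1 ≤ topReal n ∧ lam.1.card = k}

/-- Partitions of `k` in the interval `[s, t]`, over `ℂ`. -/
def IndexComplex (n k : ℕ) : Type :=
  {lam : YoungDiagram // botPartition ≤ lam ∧ lam ≤ topComplex n ∧ lam.card = k}

/-- Strict partitions of `k` in the interval `[s, t]`, over the quaternions. -/
def IndexQuaternion (n k : ℕ) : Type :=
  {lam : {lam : YoungDiagram // IsStrictPartition lam} //
    botPartition ≤ lam.1 ∧ lam.1 ≤ topQuaternion n ∧ lam.1.card = k}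

/-- `L^k` over `ℝ`: the sum of the components `S_{d₊(λ)} U` of `⋀^k (Sym² U)`, `dim U = n + 1`,
for `λ` in the interval `[s, t]`. -/
abbrev LReal (n k : ℕ) : Type :=
  ⨁ lam : IndexReal n k, schurFunctor (dPlus lam.1.1 lam.1.2) (Fin (n + 1) → ℂ)

/-- `L^k` over `ℂ`: the sum of the components `S_λ U ⊗ S_{λ^∨} V` of `⋀^k (U ⊗ V)`,
`dim U = dim V = n + 1`, for `λ` in the interval `[s, t]`. -/
abbrev LComplex (n k : ℕ) : Type :=
  ⨁ lam : IndexComplex n k,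
    schurFunctor lam.1 (Fin (n + 1) → ℂ) ⊗[ℂ] schurFunctor lam.1.transpose (Fin (n + 1) → ℂ)

/-- `L^k` over the quaternions: the sum of the components `S_{d₋(λ)} U` of `⋀^k (⋀² U)`,
`dim U = 2n + 2`, for `λ` in the interval `[s, t]`. -/
abbrev LQuaternion (n k : ℕ) : Type :=
  ⨁ lam : IndexQuaternion n k, schurFunctor (dMinus lam.1.1 lam.1.2) (Fin (2 * n + 2) → ℂ)

/-- The associative real Hurwitz algebras `ℝ`, `ℂ` and the quaternions. -/
inductive HurwitzAlgebra : Type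
  | real
  | complex
  | quaternion

/-- The dimension `a = 1, 2, 4` of the algebra as a real vector space. -/
def HurwitzAlgebra.dim : HurwitzAlgebra → ℕ
  | real => 1
  | complex => 2
  | quaternion => 4

/-- `f_k^{a,n} = dim L^{k+1}`. -/
noncomputable def faceNumber : HurwitzAlgebra → ℕ → ℕ → ℕ
  | .real, n, k => Module.finrank ℂ (LReal n (k + 1))
  | .complex, n, k => Module.finrank ℂ (LComplex n (k + 1))
  | .quaternion, n, k => Module.finrank ℂ (LQuaternion n (k + 1))

/-!
# Alternating sums of dimensions of Schur functors

The proof has two halves: the hook content formula for the Schur functors defined by Young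
symmetrizers, and three identities between the resulting numbers.

**Hook content formula.** Let `a` and `b` be the row symmetrizer and the column antisymmetrizer of
a diagram `μ`. Every `a g b` is a multiple of `a b` (`rowOp_mul_colOp_sandwich`), so
`(a b)² = n_μ • a b` for an integer `n_μ` which does not depend on the space on which `a b` acts.
Hence `n_μ` times the rank of `a b` is its trace.

* The trace on `(ℂ^N)^{⊗|μ|}` is `∏ (N + content)` (`IsBoxSet.youngTrace_eq_prod`). Taking the
  partial trace over the tensor factor of a corner box leaves `N` plus the number of boxes to its
  left minus the number of boxes above it, together with terms that pair a box to its left with a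
  box above it. These terms cancel because such a pair spans a rectangle with a fourth box in `μ`.
* The scalar `n_μ` is the product of the hook lengths (`youngScalar_eq_prod_hookLength`). The map
  sending a basis tensor to the product of the variables `X (row, colour)` over its boxes has the
  same kernel as `a`, so the image of `a b` is isomorphic to the span of the bideterminants. If
  `N` is the length of the first column, that column contributes the nonzero determinant of the
  generic `N × N` matrix to every bideterminant, so removing the column does not change the rank.
  Comparing traces yields `n_μ = n_ν * ∏ (hook lengths in the first column)` for the remaining
  diagram `ν`.

**Identities.** With `w p = (-1)^p * legendreCoeff m p`, the coefficients of the shifted Legendre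
polynomial of degree `m`, the dimensions for `a = 1` are `legendreCoeff (n + 1) p / 2`, and the sum
is a value of that polynomial at `1`. For `a = 4` and `m = 2 n + 1` the dimension attached to
`(p, q)` with `0 < q < p` is `legendreCoeff m p * legendreCoeff m q * ((p - q) / (p + q))² / 4`.
Writing `(p - q)² = (p + q)² - 4 p q` leaves the sum of `w p * w q * p q / (p + q)²`, which is `m`:
for fixed `p` the inner sum is a partial fraction expansion of a product of linear factors
(`sum_partialFraction`). For `a = 2` the sum over hooks is evaluated in the same way
(`sum_sum_hookCoeff`).
-/

/-! ### Traces of Young symmetrizers on tensor powers -/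

open Equiv

/-- The permutations of `κ` that preserve the fibres of `r`. -/
def fiberPerms {κ : Type*} [Fintype κ] [DecidableEq κ] (r : κ → ℕ) : Finset (Perm κ) :=
  Finset.univ.filter fun σ => ∀ k, r (σ k) = r k

section FiberPerms

variable {κ : Type*} [Fintype κ] [DecidableEq κ] {r : κ → ℕ}

theorem mem_fiberPerms {σ : Perm κ} : σ ∈ fiberPerms r ↔ ∀ k, r (σ k) = r k := by
  simp [fiberPerms]

theorem one_mem_fiberPerms : (1 : Perm κ) ∈ fiberPerms r := by
  simp [mem_fiberPerms]

theorem mul_mem_fiberPerms {σ τ : Perm κ} (hσ : σ ∈ fiberPerms r) (hτ : τ ∈ fiberPerms r) :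
    σ * τ ∈ fiberPerms r := by
  rw [mem_fiberPerms] at *
  intro k
  rw [Perm.mul_apply, hσ, hτ]

theorem inv_mem_fiberPerms {σ : Perm κ} (hσ : σ ∈ fiberPerms r) : σ⁻¹ ∈ fiberPerms r := by
  rw [mem_fiberPerms] at *
  intro k
  rw [← hσ (σ⁻¹ k), show σ (σ⁻¹ k) = k from σ.apply_symm_apply k]

theorem swap_mem_fiberPerms {x y : κ} (h : r x = r y) : swap x y ∈ fiberPerms r := by
  rw [mem_fiberPerms]
  intro k
  rw [swap_apply_def]
  split_ifs with h1 h2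
  · rw [h1, h]
  · rw [h2, h]
  · rfl

theorem sum_fiberPerms_mul_left {M : Type*} [AddCommMonoid M] {τ : Perm κ}
    (hτ : τ ∈ fiberPerms r) (G : Perm κ → M) :
    ∑ σ ∈ fiberPerms r, G (τ * σ) = ∑ σ ∈ fiberPerms r, G σ := by
  refine Finset.sum_nbij' (fun σ => τ * σ) (fun σ => τ⁻¹ * σ) ?_ ?_ ?_ ?_ ?_
  · exact fun σ hσ => mul_mem_fiberPerms hτ hσ
  · exact fun σ hσ => mul_mem_fiberPerms (inv_mem_fiberPerms hτ) hσ
  · intro σ _; simp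
  · intro σ _; simp
  · intro σ _; rfl

theorem sum_fiberPerms_mul_right {M : Type*} [AddCommMonoid M] {τ : Perm κ}
    (hτ : τ ∈ fiberPerms r) (G : Perm κ → M) :
    ∑ σ ∈ fiberPerms r, G (σ * τ) = ∑ σ ∈ fiberPerms r, G σ := by
  refine Finset.sum_nbij' (fun σ => σ * τ) (fun σ => σ * τ⁻¹) ?_ ?_ ?_ ?_ ?_
  · exact fun σ hσ => mul_mem_fiberPerms hσ hτ
  · exact fun σ hσ => mul_mem_fiberPerms hσ (inv_mem_fiberPerms hτ)
  · intro σ _; simp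
  · intro σ _; simp
  · intro σ _; rfl

theorem sum_fiberPerms_inv {M : Type*} [AddCommMonoid M] (G : Perm κ → M) :
    ∑ σ ∈ fiberPerms r, G σ⁻¹ = ∑ σ ∈ fiberPerms r, G σ := by
  refine Finset.sum_nbij' (fun σ => σ⁻¹) (fun σ => σ⁻¹) ?_ ?_ ?_ ?_ ?_
  · exact fun σ hσ => inv_mem_fiberPerms hσ
  · exact fun σ hσ => inv_mem_fiberPerms hσ
  · intro σ _; simp
  · intro σ _; simp
  · intro σ _; rfl

/-- A fibre-preserving permutation of `Option κ` is a transposition of `none` with an element of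
its fibre, times a fibre-preserving permutation of `κ`. -/
theorem sum_fiberPerms_option {M : Type*} [AddCommMonoid M] (r : Option κ → ℕ)
    (G : Perm (Option κ) → M) :
    ∑ σ ∈ fiberPerms r, G σ =
      ∑ y with r y = r none, ∑ σ ∈ fiberPerms (r ∘ some), G (swap none y * optionCongr σ) := by
  rw [← Finset.sum_product']
  symm
  refine Finset.sum_bij (fun a _ => Perm.decomposeOption.symm a) ?_ ?_ ?_ ?_
  · rintro ⟨y, σ⟩ h
    rw [Finset.mem_product, Finset.mem_filter] at h
    refine mul_mem_fiberPerms (swap_mem_fiberPerms h.1.2.symm) (mem_fiberPerms.2 ?_)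
    rintro (_ | k)
    · rfl
    · exact mem_fiberPerms.1 h.2 k
  · intro a _ b _ h
    exact Perm.decomposeOption.symm.injective h
  · intro σ hσ
    have h0 : r (σ none) = r none := mem_fiberPerms.1 hσ none
    refine ⟨Perm.decomposeOption σ, ?_, by simp⟩
    rw [Finset.mem_product, Finset.mem_filter]
    refine ⟨⟨Finset.mem_univ _, h0⟩, ?_⟩
    have h1 : optionCongr (removeNone σ) ∈ fiberPerms r := by
      rw [map_equiv_removeNone]
      exact mul_mem_fiberPerms (swap_mem_fiberPerms h0.symm) hσ
    exact mem_fiberPerms.2 fun k => mem_fiberPerms.1 h1 (some k)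
  · intro a _
    rfl

end FiberPerms

/-- The number of `N`-colourings of `κ` that are constant on the cycles of `σ`, i.e. `N` to the
number of cycles of `σ`. It is the trace of `σ` permuting the factors of `(ℂ^N)^{⊗κ}`. -/
def fixedColorings {κ : Type*} [Fintype κ] [DecidableEq κ] (N : ℕ) (σ : Perm κ) : ℕ :=
  Fintype.card {f : κ → Fin N // ∀ k, f (σ k) = f k}

section FixedColorings

variable {κ : Type*} [Fintype κ] [DecidableEq κ] {N : ℕ}

theorem fixedColorings_mul_comm (σ τ : Perm κ) :
    fixedColorings N (σ * τ) = fixedColorings N (τ * σ) := by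
  refine Fintype.card_congr ⟨fun f => ⟨f.1 ∘ σ, fun k => f.2 (σ k)⟩,
    fun f => ⟨f.1 ∘ τ, fun k => f.2 (τ k)⟩, fun f => ?_, fun f => ?_⟩
  · ext k; exact congrArg Fin.val (f.2 k)
  · ext k; exact congrArg Fin.val (f.2 k)

theorem fixedColorings_optionCongr (σ : Perm κ) :
    fixedColorings N (optionCongr σ) = N * fixedColorings N σ := by
  have e : {f : Option κ → Fin N // ∀ k, f (optionCongr σ k) = f k} ≃
      Fin N × {f : κ → Fin N // ∀ k, f (σ k) = f k} :=
    { toFun := fun f => (f.1 none, ⟨f.1 ∘ some, fun k => f.2 (some k)⟩)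
      invFun := fun a => ⟨fun o => o.elim a.1 a.2.1, by
        rintro (_ | k)
        · rfl
        · exact a.2.2 k⟩
      left_inv := fun f => by
        ext (_ | k) <;> rfl
      right_inv := fun a => rfl }
  rw [fixedColorings, Fintype.card_congr e, Fintype.card_prod, Fintype.card_fin]
  rfl

/-- If `g` maps `none` to `some y` and restricts to `ρ` after collapsing `none` to `y`, then
colourings fixed by `g` are determined by their restriction to `κ`. -/
theorem fixedColorings_of_collapse (g : Perm (Option κ)) (ρ : Perm κ) (y : κ)
    (h0 : g none = some y) (h : ∀ k, (g (some k)).getD y = ρ k) :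
    fixedColorings N g = fixedColorings N ρ := by
  have key : ∀ (f : Option κ → Fin N), f none = f (some y) →
      ∀ o, f o = f (some (o.getD y)) := by
    rintro f hf (_ | k)
    · exact hf
    · rfl
  refine Fintype.card_congr ⟨fun f => ⟨f.1 ∘ some, fun k => ?_⟩,
    fun f => ⟨fun o => f.1 (o.getD y), ?_⟩, fun f => ?_, fun f => ?_⟩
  · have h1 : f.1 none = f.1 (some y) := by rw [← f.2 none, h0]
    rw [Function.comp_apply, Function.comp_apply, ← f.2 (some k), key _ h1 (g (some k)), h]
  · rintro (_ | k)
    · simp [h0]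
    · simp only [h, Option.getD_some]
      exact f.2 k
  · have h1 : f.1 none = f.1 (some y) := by rw [← f.2 none, h0]
    apply Subtype.ext
    funext o
    exact (key _ h1 o).symm
  · rfl

theorem fixedColorings_swap_none_mul (y : κ) (ρ : Perm κ) :
    fixedColorings N (swap none (some y) * optionCongr ρ) = fixedColorings N ρ := by
  refine fixedColorings_of_collapse _ ρ y (by simp) fun k => ?_
  by_cases h : ρ k = y
  · simp [h]
  · rw [Perm.mul_apply, optionCongr_apply, Option.map_some,
      swap_apply_of_ne_of_ne (by simp) (by simpa using h)]
    rfl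

theorem fixedColorings_swap_none_mul_swap_none_mul {y y' : κ} (hy : y ≠ y') (ρ : Perm κ) :
    fixedColorings N (swap none (some y') * (swap none (some y) * optionCongr ρ)) =
      fixedColorings N (swap y y' * ρ) := by
  refine fixedColorings_of_collapse _ _ y ?_ fun k => ?_
  · rw [Perm.mul_apply, Perm.mul_apply, optionCongr_apply, Option.map_none, swap_apply_left,
      swap_apply_of_ne_of_ne] <;> simp [hy]
  · rw [Perm.mul_apply, Perm.mul_apply, optionCongr_apply, Option.map_some, Perm.mul_apply]
    by_cases h : ρ k = y
    · simp [h]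
    · have h1 : swap none (some y) (some (ρ k)) = some (ρ k) :=
        swap_apply_of_ne_of_ne (by simp) (by simpa using h)
      rw [h1]
      by_cases h' : ρ k = y'
      · simp [h']
      · rw [swap_apply_of_ne_of_ne (by simp) (by simpa using h'), swap_apply_of_ne_of_ne h h']
        rfl

end FixedColorings

/-- The trace of the Young symmetrizer of the box set `κ`, with rows given by `r` and columns
given by `c`, on `(ℂ^N)^{⊗κ}`. -/
def youngTrace {κ : Type*} [Fintype κ] [DecidableEq κ] (N : ℕ) (r c : κ → ℕ) : ℤ :=
  ∑ p ∈ fiberPerms r, ∑ q ∈ fiberPerms c, (Perm.sign q : ℤ) * fixedColorings N (p * q)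

section YoungTrace

variable {κ : Type*} [Fintype κ] [DecidableEq κ] {N : ℕ}

theorem youngTrace_eq_sum_inv (r c : κ → ℕ) :
    youngTrace N r c = ∑ p ∈ fiberPerms r, ∑ q ∈ fiberPerms c,
      (Perm.sign q : ℤ) * fixedColorings N (p * q⁻¹) := by
  refine Finset.sum_congr rfl fun p _ => ?_
  rw [← sum_fiberPerms_inv]
  simp

/-- A transposition joining a row to a column through a third box contributes nothing: the
transpositions inside the row and the column of the third box cancel the terms in pairs. -/
theorem sum_sign_mul_fixedColorings_swap_eq_zero {r c : κ → ℕ} {y y' w : κ}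
    (hwy : w ≠ y) (hwy' : w ≠ y') (hr : r w = r y') (hc : c w = c y) :
    ∑ p ∈ fiberPerms r, ∑ q ∈ fiberPerms c,
      (Perm.sign q : ℤ) * fixedColorings N (swap y y' * (p * q⁻¹)) = 0 := by
  set S := ∑ p ∈ fiberPerms r, ∑ q ∈ fiberPerms c,
      (Perm.sign q : ℤ) * fixedColorings N (swap y y' * (p * q⁻¹)) with hS
  have h : S = -S := by
    conv_lhs => rw [hS]
    rw [← sum_fiberPerms_mul_left (swap_mem_fiberPerms hr.symm), hS, ← Finset.sum_neg_distrib]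
    refine Finset.sum_congr rfl fun p _ => ?_
    rw [← Finset.sum_neg_distrib, ← sum_fiberPerms_mul_left (swap_mem_fiberPerms hc.symm)]
    refine Finset.sum_congr rfl fun q _ => ?_
    have h1 : swap y y' * (swap y' w * p * (swap y w * q)⁻¹) =
        swap y w * ((swap y y' * (p * q⁻¹)) * swap y w) := by
      have h2 : swap y y' * swap y' w = swap y w * swap y y' := by
        rw [mul_swap_eq_swap_mul, swap_apply_right, swap_apply_of_ne_of_ne hwy hwy']
      rw [mul_inv_rev, swap_inv]
      simp only [← mul_assoc]
      rw [h2]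
    rw [h1, fixedColorings_mul_comm, mul_assoc, swap_mul_self, mul_one, Perm.sign_mul,
      Perm.sign_swap hwy.symm]
    simp
  omega

/-- Removing a corner box (here `none`) divides the trace of the Young symmetrizer by `N` plus the
content of that box. The trace is taken first over the tensor factor of the corner; the terms
moving the corner both in its row and in its column then cancel. -/
theorem youngTrace_option (r c : Option κ → ℕ)
    (hinj : ∀ k : κ, r (some k) = r none → c (some k) ≠ c none)
    (hcross : ∀ y y' : κ, r (some y) = r none → c (some y') = c none →
      ∃ w : κ, r (some w) = r (some y') ∧ c (some w) = c (some y)) :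
    youngTrace N r c =
      (N + ((Finset.univ.filter fun y : κ => r (some y) = r none).card : ℤ) -
        ((Finset.univ.filter fun y : κ => c (some y) = c none).card : ℤ)) *
        youngTrace N (r ∘ some) (c ∘ some) := by
  have key : ∀ y y' : Option κ, r y = r none → c y' = c none →
      ∑ p ∈ fiberPerms (r ∘ some), ∑ q ∈ fiberPerms (c ∘ some),
        (Perm.sign (swap none y' * optionCongr q) : ℤ) *
          fixedColorings N (swap none y * optionCongr p * (swap none y' * optionCongr q)⁻¹) =
      (if y = none then (if y' = none then (N : ℤ) else -1) else if y' = none then 1 else 0) *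
        youngTrace N (r ∘ some) (c ∘ some) := by
    intro y y' hy hy'
    have hF : ∀ p q : Perm κ, fixedColorings N
        (swap none y * optionCongr p * (swap none y' * optionCongr q)⁻¹) =
        fixedColorings N (swap none y' * (swap none y * optionCongr (p * q⁻¹))) := by
      intro p q
      rw [mul_inv_rev, swap_inv, ← mul_assoc, fixedColorings_mul_comm, mul_assoc]
      congr 3
      ext1 (_ | k)
      · rfl
      · rfl
    simp only [hF]
    rw [youngTrace_eq_sum_inv]
    -- fixing the corner leaves `N` colours for it; one transposition merges it into its row or
    -- column; two transpositions merge it and leave behind `swap y y'`, which sums to zero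
    rcases y with _ | y <;> rcases y' with _ | y'
    · simp only [swap_self, ← Perm.one_def, one_mul, fixedColorings_optionCongr]
      simp only [if_true, Finset.mul_sum, optionCongr_sign]
      refine Finset.sum_congr rfl fun p _ => Finset.sum_congr rfl fun q _ => ?_
      push_cast; ring
    · simp only [swap_self, ← Perm.one_def, one_mul, fixedColorings_swap_none_mul]
      simp [Finset.mul_sum]
    · simp only [swap_self, ← Perm.one_def, one_mul, fixedColorings_swap_none_mul]
      simp
    · have hne : y ≠ y' := by
        rintro rfl
        exact hinj y hy hy'
      obtain ⟨w, hw, hw'⟩ := hcross y y' hy hy'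
      have h0 := sum_sign_mul_fixedColorings_swap_eq_zero (N := N) (r := r ∘ some)
        (c := c ∘ some) (w := w) (by
          rintro rfl
          exact hinj y' (hw.symm.trans hy) hy') (by
          rintro rfl
          exact hinj y hy (hw'.symm.trans hy')) hw hw'
      simp only [fixedColorings_swap_none_mul_swap_none_mul hne, Perm.sign_mul]
      have h1 : Perm.sign (swap none (some y')) = -1 := Perm.sign_swap (by simp)
      simp only [h1, optionCongr_sign]
      push_cast
      simp only [neg_mul, one_mul, Finset.sum_neg_distrib, h0]
      simp
  rw [youngTrace_eq_sum_inv, sum_fiberPerms_option]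
  simp only [sum_fiberPerms_option c]
  have h2 : ∀ y ∈ Finset.univ.filter (fun y : Option κ => r y = r none),
      ∑ p ∈ fiberPerms (r ∘ some), ∑ y' with c y' = c none, ∑ q ∈ fiberPerms (c ∘ some),
        (Perm.sign (swap none y' * optionCongr q) : ℤ) *
          fixedColorings N (swap none y * optionCongr p * (swap none y' * optionCongr q)⁻¹) =
      ∑ y' with c y' = c none,
        (if y = none then (if y' = none then (N : ℤ) else -1) else if y' = none then 1 else 0) *
        youngTrace N (r ∘ some) (c ∘ some) := by
    intro y hy
    rw [Finset.sum_comm]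
    refine Finset.sum_congr rfl fun y' hy' => key y y' ?_ ?_
    · exact (Finset.mem_filter.1 hy).2
    · exact (Finset.mem_filter.1 hy').2
  rw [Finset.sum_congr rfl h2]
  simp only [← Finset.sum_mul]
  congr 1
  simp only [Finset.sum_filter, Fintype.sum_option]
  simp [Finset.sum_ite]
  ring

end YoungTrace

/-! ### The content polynomial, and products of row and column permutations -/

/-- The boxes `κ`, placed in rows `r` and columns `c`, form a Young diagram. -/
structure IsBoxSet {κ : Type*} (r c : κ → ℕ) : Prop where
  inj : ∀ k k', r k = r k' → c k = c k' → k = k'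
  lower : ∀ k i j, i ≤ r k → j ≤ c k → ∃ w, r w = i ∧ c w = j

section BoxSet

variable {κ : Type*} {N : ℕ} {r c : κ → ℕ}

theorem IsBoxSet.swap (h : IsBoxSet r c) : IsBoxSet c r where
  inj k k' h1 h2 := h.inj k k' h2 h1
  lower k i j h1 h2 := (h.lower k j i h2 h1).imp fun _ => And.symm

variable [Fintype κ]

theorem IsBoxSet.card_filter_row (h : IsBoxSet r c) (x : κ)
    (hx : ∀ k, r k = r x → c k ≤ c x) :
    (Finset.univ.filter fun y => r y = r x).card = c x + 1 := by
  rw [← Finset.card_range (c x + 1)]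
  refine Finset.card_nbij c ?_ ?_ ?_
  · intro y hy
    have := hx y (Finset.mem_filter.1 hy).2
    simp; omega
  · intro y hy z hz hyz
    simp only [Finset.coe_filter, Finset.mem_univ, true_and, Set.mem_ofPred_eq] at hy hz
    exact h.inj _ _ (hy.trans hz.symm) hyz
  · intro j hj
    simp only [Finset.coe_range, Set.mem_Iio] at hj
    obtain ⟨w, hw, hw'⟩ := h.lower x (r x) j le_rfl (by omega)
    exact ⟨w, by simpa using hw, hw'⟩

/-- A rearrangement of the column indices of a Young diagram that is injective on every row
places the boxes in the same Young diagram: no other arrangement has as many boxes in the first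
`m` columns for every `m`. -/
theorem IsBoxSet.exists_of_injective_on_rows (h : IsBoxSet r c) (g : Perm κ)
    (hg : ∀ k k', r k = r k' → c (g k) = c (g k') → k = k') (u : κ) :
    ∃ w, r w = r u ∧ c w = c (g u) := by
  by_contra hu
  push Not at hu
  set m := c (g u) with hm
  have hcount : (Finset.univ.filter fun k => c (g k) < m).card =
      (Finset.univ.filter fun k => c k < m).card := Finset.card_equiv g (by simp)
  -- in no row does the rearrangement have more boxes in the first `m` columns than the diagram
  have hle : ∀ i ∈ Finset.univ.image r,
      ((Finset.univ.filter fun k => c (g k) < m).filter fun k => r k = i).card ≤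
      ((Finset.univ.filter fun k => c k < m).filter fun k => r k = i).card := by
    intro i _
    by_cases hi : ∃ k, r k = i ∧ m ≤ c k
    · obtain ⟨k, hk, hkm⟩ := hi
      have h1 : ((Finset.univ.filter fun k => c (g k) < m).filter fun k => r k = i).card ≤
          (Finset.range m).card := by
        refine Finset.card_le_card_of_injOn (fun k => c (g k)) ?_ ?_
        · intro y hy
          simp at hy ⊢
          exact hy.1
        · intro y hy z hz hyz
          simp at hy hz
          exact hg _ _ (hy.2.trans hz.2.symm) hyz
      refine h1.trans ?_
      refine Finset.card_le_card_of_surjOn c ?_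
      intro j hj
      simp at hj
      obtain ⟨w, hw, hw'⟩ := h.lower k i j hk.ge (by omega)
      exact ⟨w, by simp; omega, hw'⟩
    · push Not at hi
      refine Finset.card_le_card fun k hk => ?_
      simp at hk ⊢
      exact ⟨hi k hk.2, hk.2⟩
  have hmaps : ∀ s : Finset κ, ∀ k ∈ s, r k ∈ Finset.univ.image r :=
    fun s k _ => Finset.mem_image_of_mem r (Finset.mem_univ k)
  rw [Finset.card_eq_sum_card_fiberwise (hmaps _), Finset.card_eq_sum_card_fiberwise (hmaps _),
    Finset.sum_eq_sum_iff_of_le hle] at hcount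
  have h1 := hcount (r u) (Finset.mem_image_of_mem r (Finset.mem_univ u))
  -- the row of `u` lies in the first `m` columns, but `g` moves `u` out of them
  have hlt : ∀ k, r k = r u → c k < m := by
    intro k hk
    by_contra hkm
    obtain ⟨w, hw, hw'⟩ := h.lower k (r u) m hk.ge (by omega)
    exact hu w hw hw'
  have h2 : ((Finset.univ.filter fun k => c k < m).filter fun k => r k = r u) =
      Finset.univ.filter fun k => r k = r u := by
    ext k
    simp only [Finset.mem_filter, Finset.mem_univ, true_and, and_iff_right_iff_imp]
    exact hlt k
  rw [h2] at h1
  have h3 := Finset.eq_of_subset_of_card_le (s := (Finset.univ.filter fun k => c (g k) < m).filter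
    fun k => r k = r u) (t := Finset.univ.filter fun k => r k = r u)
    (fun k hk => by simp at hk ⊢; exact hk.2) h1.ge
  have h4 : u ∈ Finset.univ.filter fun k => r k = r u := by simp
  rw [← h3] at h4
  simp [← hm] at h4

variable [DecidableEq κ]

theorem fixedColorings_permCongr {κ' : Type*} [Fintype κ'] [DecidableEq κ'] (e : κ' ≃ κ)
    (σ : Perm κ') : fixedColorings N (e.permCongr σ) = fixedColorings N σ := by
  refine Fintype.card_congr ⟨fun f => ⟨f.1 ∘ e, fun k => ?_⟩,
    fun f => ⟨f.1 ∘ e.symm, fun k => ?_⟩, fun f => ?_, fun f => ?_⟩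
  · simpa using f.2 (e k)
  · simpa using f.2 (e.symm k)
  · ext k; simp
  · ext k; simp

theorem sum_fiberPerms_equiv {κ' M : Type*} [Fintype κ'] [DecidableEq κ'] [AddCommMonoid M]
    (e : κ' ≃ κ) (r : κ → ℕ) (G : Perm κ → M) :
    ∑ σ ∈ fiberPerms (r ∘ e), G (e.permCongr σ) = ∑ σ ∈ fiberPerms r, G σ := by
  refine Finset.sum_equiv e.permCongr (fun σ => ?_) (fun σ _ => rfl)
  rw [mem_fiberPerms, mem_fiberPerms, ← e.forall_congr_right]
  simp

theorem youngTrace_equiv {κ' : Type*} [Fintype κ'] [DecidableEq κ'] (e : κ' ≃ κ)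
    (r c : κ → ℕ) : youngTrace N (r ∘ e) (c ∘ e) = youngTrace N r c := by
  rw [youngTrace, youngTrace, ← sum_fiberPerms_equiv e]
  refine Finset.sum_congr rfl fun p _ => ?_
  rw [← sum_fiberPerms_equiv e]
  refine Finset.sum_congr rfl fun q _ => ?_
  rw [Perm.sign_permCongr]
  congr 2
  rw [← fixedColorings_permCongr e]
  congr 1
  ext k
  simp

/-- The trace of the Young symmetrizer is the content polynomial of the diagram. -/
theorem IsBoxSet.youngTrace_eq_prod (h : IsBoxSet r c) :
    youngTrace N r c = ∏ k, ((N : ℤ) + c k - r k) := by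
  obtain ⟨n, hn⟩ : ∃ n, Fintype.card κ = n := ⟨_, rfl⟩
  induction n generalizing κ with
  | zero =>
    have := Fintype.card_eq_zero_iff.1 hn
    have h1 : fiberPerms r = {1} := by
      ext σ; simp [mem_fiberPerms, Subsingleton.elim σ 1]
    have h2 : fiberPerms c = {1} := by
      ext σ; simp [mem_fiberPerms, Subsingleton.elim σ 1]
    simp [youngTrace, h1, h2, fixedColorings]
  | succ n ih =>
    have hne : Nonempty κ := Fintype.card_pos_iff.1 (by omega)
    -- a box with maximal `row + column` is a corner
    obtain ⟨x, -, hx⟩ := Finset.exists_max_image Finset.univ (fun k => r k + c k)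
      Finset.univ_nonempty
    replace hx : ∀ k, r k + c k ≤ r x + c x := fun k => hx k (Finset.mem_univ k)
    let e : Option {k // k ≠ x} ≃ κ := optionSubtypeNe x
    have h' : IsBoxSet ((r ∘ e) ∘ some) ((c ∘ e) ∘ some) := by
      refine ⟨fun k k' h1 h2 => Subtype.ext (h.inj _ _ h1 h2), fun k i j hi hj => ?_⟩
      obtain ⟨w, hw, hw'⟩ := h.lower k.1 i j hi hj
      refine ⟨⟨w, ?_⟩, hw, hw'⟩
      rintro rfl
      have h1 := hx k.1
      have h2 : i ≤ r k.1 := hi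
      have h3 : j ≤ c k.1 := hj
      exact k.2 (h.inj _ _ (by omega) (by omega))
    have hcard : Fintype.card {k // k ≠ x} = n := by
      rw [Fintype.card_subtype_compl, Fintype.card_subtype_eq, hn]; rfl
    have hrow := h.card_filter_row x fun k hk => by have := hx k; omega
    have hcol := h.swap.card_filter_row x fun k hk => by have := hx k; omega
    rw [← youngTrace_equiv e, youngTrace_option, ih h' hcard, ← e.prod_comp,
      Fintype.prod_option]
    · have hr : (Finset.univ.filter fun y : {k // k ≠ x} => (r ∘ e) (some y) = (r ∘ e) none).card
          = c x := by
        have : (Finset.univ.filter fun y => r y = r x).card =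
            (Finset.univ.filter fun y : Option {k // k ≠ x} => (r ∘ e) y = (r ∘ e) none).card := by
          symm
          exact Finset.card_equiv e (by simp [e])
        rw [hrow, Finset.card_filter, Fintype.sum_option, ← Finset.card_filter] at this
        simp only [if_true] at this
        omega
      have hc : (Finset.univ.filter fun y : {k // k ≠ x} => (c ∘ e) (some y) = (c ∘ e) none).card
          = r x := by
        have : (Finset.univ.filter fun y => c y = c x).card =
            (Finset.univ.filter fun y : Option {k // k ≠ x} => (c ∘ e) y = (c ∘ e) none).card := by
          symm
          exact Finset.card_equiv e (by simp [e])
        rw [hcol, Finset.card_filter, Fintype.sum_option, ← Finset.card_filter] at this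
        simp only [if_true] at this
        omega
      rw [hr, hc]
      rfl
    · intro k h1 h2
      exact k.2 (h.inj _ _ h1 h2)
    · intro y y' h1 h2
      have h3 := hx y.1
      have h4 := hx y'.1
      have h1 : r y.1 = r x := h1
      have h2 : c y'.1 = c x := h2
      exact h'.lower y _ _ (by simp [e]; omega) le_rfl

/-- Either two boxes of one row come from one column under `g`, or `g` is a product of a row
permutation and a column permutation. -/
theorem IsBoxSet.exists_swap_or_exists_mul (h : IsBoxSet r c) (g : Perm κ) :
    (∃ u v, u ≠ v ∧ r u = r v ∧ c (g⁻¹ u) = c (g⁻¹ v)) ∨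
      ∃ p ∈ fiberPerms r, ∃ q ∈ fiberPerms c, g = p * q := by
  by_cases hg : ∃ u v, u ≠ v ∧ r u = r v ∧ c (g⁻¹ u) = c (g⁻¹ v)
  · exact Or.inl hg
  push Not at hg
  replace hg : ∀ k k', r k = r k' → c (g⁻¹ k) = c (g⁻¹ k') → k = k' := by
    intro k k' h1 h2
    by_contra h3
    exact hg k k' h3 h1 h2
  choose p hp hp' using h.exists_of_injective_on_rows g⁻¹ hg
  have hinj : Function.Injective p := by
    intro k k' hk
    exact hg k k' (by rw [← hp, ← hp k', hk]) (by rw [← hp', ← hp' k', hk])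
  let P : Perm κ := Equiv.ofBijective p hinj.bijective_of_finite
  refine Or.inr ⟨P⁻¹, inv_mem_fiberPerms (mem_fiberPerms.2 hp), P * g,
    mem_fiberPerms.2 fun k => ?_, by simp⟩
  have := hp' (g k)
  rw [show g⁻¹ (g k) = k from g.symm_apply_apply k] at this
  exact this

end BoxSet

/-! ### The Young symmetrizer is proportional to an idempotent -/

section Sandwich

variable {κ : Type*} [Fintype κ] [DecidableEq κ]

open scoped Classical in
/-- The coefficient `s` such that `a g b = s • a b`, where `a` is the row symmetrizer and `b` the
column antisymmetrizer. The sign of `q` in `g = p q` is well defined because only the identity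
preserves both rows and columns; the definition merely picks one factorization. -/
noncomputable def sandwichCoeff (r c : κ → ℕ) (g : Perm κ) : ℤ :=
  if h : ∃ q ∈ fiberPerms c, ∃ p ∈ fiberPerms r, g = p * q then Perm.sign h.choose else 0

/-- The scalar `n` with `(a b)² = n • a b` for the Young symmetrizer `a b`. -/
noncomputable def youngScalar (r c : κ → ℕ) : ℤ :=
  ∑ q ∈ fiberPerms c, ∑ p ∈ fiberPerms r, (Perm.sign q : ℤ) * sandwichCoeff r c (q * p)

variable {V : Type*} [AddCommGroup V] [Module ℂ V] (ρ : Perm κ →* Module.End ℂ V) {r c : κ → ℕ}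

/-- The row symmetrizer in a representation `ρ`. -/
noncomputable def rowOp (r : κ → ℕ) : Module.End ℂ V := ∑ p ∈ fiberPerms r, ρ p

/-- The column antisymmetrizer in a representation `ρ`. -/
noncomputable def colOp (c : κ → ℕ) : Module.End ℂ V :=
  ∑ q ∈ fiberPerms c, ((Perm.sign q : ℤ) : ℂ) • ρ q

theorem rowOp_mul {p : Perm κ} (hp : p ∈ fiberPerms r) : rowOp ρ r * ρ p = rowOp ρ r := by
  simp only [rowOp, Finset.sum_mul, ← map_mul]
  exact sum_fiberPerms_mul_right hp _

theorem mul_colOp {q : Perm κ} (hq : q ∈ fiberPerms c) :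
    ρ q * colOp ρ c = ((Perm.sign q : ℤ) : ℂ) • colOp ρ c := by
  simp only [colOp]
  conv_rhs => rw [← sum_fiberPerms_mul_left hq]
  rw [Finset.mul_sum, Finset.smul_sum]
  refine Finset.sum_congr rfl fun σ _ => ?_
  have h1 : ((Perm.sign q : ℤ) : ℂ) * ((Perm.sign q : ℤ) : ℂ) = 1 := by
    rw [← Int.cast_mul, ← Units.val_mul, Int.units_mul_self]
    simp
  rw [mul_smul_comm, ← map_mul, smul_smul, Perm.sign_mul, Units.val_mul, Int.cast_mul, ← mul_assoc,
    h1, one_mul]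

/-- If `g = p q`, then `p` and `q` are absorbed up to the sign of `q`. Otherwise a row
transposition absorbed by `a` passes through `g` to a column transposition, which changes the
sign. -/
theorem rowOp_mul_colOp_sandwich (h : IsBoxSet r c) (g : Perm κ) :
    rowOp ρ r * ρ g * colOp ρ c = (sandwichCoeff r c g : ℂ) • (rowOp ρ r * colOp ρ c) := by
  rw [sandwichCoeff]
  split_ifs with hg
  · obtain ⟨hq, p, hp, hpq⟩ := hg.choose_spec
    conv_lhs => rw [hpq, map_mul, ← mul_assoc, rowOp_mul ρ hp, mul_assoc, mul_colOp ρ hq]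
    rw [mul_smul_comm]
  · rcases h.exists_swap_or_exists_mul g with ⟨u, v, huv, hr, hc⟩ | ⟨p, hp, q, hq, hpq⟩
    · have h1 : rowOp ρ r * ρ g * colOp ρ c = -(rowOp ρ r * ρ g * colOp ρ c) := by
        conv_lhs => rw [← rowOp_mul ρ (swap_mem_fiberPerms hr), mul_assoc (rowOp ρ r), ← map_mul,
          swap_mul_eq_mul_swap, map_mul, ← mul_assoc, mul_assoc _ _ (colOp ρ c),
          mul_colOp ρ (swap_mem_fiberPerms hc), Perm.sign_swap (by simpa using huv)]
        simp
      rw [Int.cast_zero, zero_smul]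
      have h2 : (2 : ℂ) • (rowOp ρ r * ρ g * colOp ρ c) = 0 := by
        rw [two_smul]
        nth_rewrite 1 [h1]
        exact neg_add_cancel _
      exact (smul_eq_zero.1 h2).resolve_left two_ne_zero
    · exact absurd ⟨q, hq, p, hp, hpq⟩ hg

/-- The Young symmetrizer is proportional to an idempotent. -/
theorem youngSymmetrizer_sq (h : IsBoxSet r c) :
    (rowOp ρ r * colOp ρ c) * (rowOp ρ r * colOp ρ c) =
      (youngScalar r c : ℂ) • (rowOp ρ r * colOp ρ c) := by
  have h1 : (rowOp ρ r * colOp ρ c) * (rowOp ρ r * colOp ρ c) =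
      ∑ q ∈ fiberPerms c, ∑ p ∈ fiberPerms r,
        ((Perm.sign q : ℤ) : ℂ) • (rowOp ρ r * ρ (q * p) * colOp ρ c) := by
    conv_lhs => rw [mul_assoc, ← mul_assoc (colOp ρ c)]
    conv_lhs =>
      enter [2, 1]
      rw [rowOp, colOp, Finset.sum_mul_sum]
    simp only [Finset.sum_mul, Finset.mul_sum, smul_mul_assoc, mul_smul_comm, map_mul, mul_assoc]
  rw [h1, youngScalar]
  simp only [rowOp_mul_colOp_sandwich ρ h, smul_smul, ← Finset.sum_smul]
  push_cast
  rfl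

end Sandwich

section Tensor

/-- Permutations of `κ` permuting the factors of `U^{⊗κ}`. -/
noncomputable def tensorRep (κ : Type) (U : Type) [AddCommGroup U] [Module ℂ U] :
    Perm κ →* Module.End ℂ (PiTensorProduct ℂ fun _ : κ => U) where
  toFun σ := (PiTensorProduct.reindex ℂ (fun _ : κ => U) σ).toLinearMap
  map_one' := by
    ext f
    simp
    rfl
  map_mul' σ τ := by
    ext f
    simp
    rfl

theorem tensorRep_tprod {κ : Type} (U : Type) [AddCommGroup U] [Module ℂ U] (σ : Perm κ)
    (f : κ → U) :
    tensorRep κ U σ (PiTensorProduct.tprod ℂ f) = PiTensorProduct.tprod ℂ (f ∘ σ.symm) := by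
  exact PiTensorProduct.reindex_tprod σ f

variable {κ : Type} [Fintype κ]

/-- The standard basis of `(ℂ^N)^{⊗κ}`, indexed by colourings of `κ`. -/
noncomputable def tensorBasis (κ : Type) [Fintype κ] (N : ℕ) :
    Module.Basis (κ → Fin N) ℂ (PiTensorProduct ℂ fun _ : κ => (Fin N → ℂ)) :=
  Basis.piTensorProduct fun _ => Pi.basisFun ℂ (Fin N)

theorem tensorRep_tensorBasis {N : ℕ} (σ : Perm κ) (f : κ → Fin N) :
    tensorRep κ (Fin N → ℂ) σ (tensorBasis κ N f) = tensorBasis κ N (f ∘ σ.symm) := by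
  simp only [tensorBasis, Basis.piTensorProduct_apply, tensorRep_tprod]
  rfl

variable [DecidableEq κ]

theorem trace_tensorRep (N : ℕ) (σ : Perm κ) :
    LinearMap.trace ℂ _ (tensorRep κ (Fin N → ℂ) σ) = fixedColorings N σ := by
  rw [LinearMap.trace_eq_matrix_trace ℂ (tensorBasis κ N), Matrix.trace, fixedColorings,
    Fintype.card_subtype, Finset.card_filter]
  push_cast
  refine Finset.sum_congr rfl fun f _ => ?_
  rw [Matrix.diag_apply, LinearMap.toMatrix_apply, tensorRep_tensorBasis, Module.Basis.repr_self,
    Finsupp.single_apply]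
  refine if_congr ⟨fun h k => ?_, fun h => ?_⟩ rfl rfl
  · have := congrFun h (σ k)
    simpa using this.symm
  · funext k
    have := h (σ.symm k)
    simpa using this.symm

theorem trace_youngSymmetrizer (N : ℕ) (r c : κ → ℕ) :
    LinearMap.trace ℂ _ (rowOp (tensorRep κ (Fin N → ℂ)) r * colOp (tensorRep κ (Fin N → ℂ)) c) =
      youngTrace N r c := by
  rw [rowOp, colOp, Finset.sum_mul_sum, map_sum, youngTrace]
  push_cast
  refine Finset.sum_congr rfl fun p _ => ?_
  rw [map_sum]
  refine Finset.sum_congr rfl fun q _ => ?_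
  rw [mul_smul_comm, ← map_mul, map_smul, trace_tensorRep, smul_eq_mul]

/-- The dimension of the image of the Young symmetrizer on `(ℂ^N)^{⊗κ}`. -/
noncomputable def youngRank (N : ℕ) (r c : κ → ℕ) : ℕ :=
  Module.finrank ℂ (LinearMap.range
    (rowOp (tensorRep κ (Fin N → ℂ)) r * colOp (tensorRep κ (Fin N → ℂ)) c))

theorem finrank_range_of_sq_eq_smul {V : Type*} [AddCommGroup V] [Module ℂ V]
    [FiniteDimensional ℂ V] {f : Module.End ℂ V} {z : ℂ} (hz : z ≠ 0) (h : f * f = z • f) :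
    z * Module.finrank ℂ (LinearMap.range f) = LinearMap.trace ℂ V f := by
  have hp : IsIdempotentElem (z⁻¹ • f) := by
    rw [IsIdempotentElem, smul_mul_smul_comm, h, smul_smul]
    congr 1
    field_simp
  have h1 := (LinearMap.IsIdempotentElem.isProj_range _ hp).trace
  rw [map_smul, smul_eq_mul, LinearMap.range_smul f _ (inv_ne_zero hz)] at h1
  rw [← h1]
  field_simp

theorem youngScalar_mul_youngRank (N : ℕ) {r c : κ → ℕ} (h : IsBoxSet r c)
    (h0 : youngScalar r c ≠ 0) :
    youngScalar r c * (youngRank N r c : ℤ) = youngTrace N r c := by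
  have h1 := finrank_range_of_sq_eq_smul (by exact_mod_cast h0)
    (youngSymmetrizer_sq (tensorRep κ (Fin N → ℂ)) h)
  rw [trace_youngSymmetrizer] at h1
  exact_mod_cast h1

/-- On a space of large dimension the Young symmetrizer has nonzero trace, so it is not
nilpotent. -/
theorem IsBoxSet.youngScalar_ne_zero {r c : κ → ℕ} (h : IsBoxSet r c) : youngScalar r c ≠ 0 := by
  intro h0
  obtain ⟨N, hN⟩ : ∃ N, ∀ k, r k < N := by
    obtain ⟨N, hN⟩ := (Set.finite_range r).bddAbove
    exact ⟨N + 1, fun k => Nat.lt_succ_of_le (hN ⟨k, rfl⟩)⟩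
  have h1 := youngSymmetrizer_sq (tensorRep κ (Fin N → ℂ)) h
  rw [h0, Int.cast_zero, zero_smul] at h1
  have h2 := (LinearMap.isNilpotent_trace_of_isNilpotent (R := ℂ)
    (f := rowOp (tensorRep κ (Fin N → ℂ)) r * colOp (tensorRep κ (Fin N → ℂ)) c)
    ⟨2, by rw [pow_two, h1]⟩).eq_zero
  rw [trace_youngSymmetrizer, h.youngTrace_eq_prod, Int.cast_eq_zero, Finset.prod_eq_zero_iff] at h2
  obtain ⟨k, -, hk⟩ := h2
  have := hN k
  omega

end Tensor

/-! ### Young diagrams as box sets -/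

/-- The row of a box. -/
def boxRow (μ : YoungDiagram) (k : μ.cells) : ℕ := k.1.1

/-- The column of a box. -/
def boxCol (μ : YoungDiagram) (k : μ.cells) : ℕ := k.1.2

theorem isBoxSet_youngDiagram (μ : YoungDiagram) : IsBoxSet (boxRow μ) (boxCol μ) where
  inj _ _ h1 h2 := Subtype.ext (Prod.ext h1 h2)
  lower k i j hi hj := ⟨⟨(i, j), μ.up_left_mem hi hj k.2⟩, rfl, rfl⟩

theorem finrank_schurFunctor (μ : YoungDiagram) (N : ℕ) :
    Module.finrank ℂ (schurFunctor μ (Fin N → ℂ)) = youngRank N (boxRow μ) (boxCol μ) := by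
  have h1 : rowSymmetrizer μ (Fin N → ℂ) = rowOp (tensorRep μ.cells (Fin N → ℂ)) (boxRow μ) := by
    rw [rowSymmetrizer, rowOp]
    symm
    refine Finset.sum_subtype _ (p := fun σ => σ ∈ rowGroup μ) (fun σ => ?_) _
    rw [mem_fiberPerms]
    rfl
  have h2 : colAntisymmetrizer μ (Fin N → ℂ) =
      colOp (tensorRep μ.cells (Fin N → ℂ)) (boxCol μ) := by
    rw [colAntisymmetrizer, colOp]
    symm
    refine (Finset.sum_subtype (F := Fintype.ofFinite {σ // σ ∈ colGroup μ}) _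
      (p := fun σ => σ ∈ colGroup μ) (fun σ => ?_) _).trans ?_
    · rw [mem_fiberPerms]
      rfl
    · refine Finset.sum_congr (by ext; simp) fun σ _ => ?_
      congr!
  rw [schurFunctor, youngRank, h1, h2]
  rfl

/-! ### Bideterminants and removal of a full column -/

section RowMonomial

variable {κ : Type} [Fintype κ] {N : ℕ}

/-- The exponent of the monomial `∏ₖ X (r k, f k)`. -/
noncomputable def rowExponent (r : κ → ℕ) (f : κ → Fin N) : ℕ × Fin N →₀ ℕ :=
  ∑ k, Finsupp.single (r k, f k) 1

/-- The monomial `∏ₖ X (r k, f k)`. -/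
noncomputable def rowMonomial (r : κ → ℕ) (f : κ → Fin N) : MvPolynomial (ℕ × Fin N) ℂ :=
  ∏ k, MvPolynomial.X (r k, f k)

theorem rowMonomial_eq_monomial (r : κ → ℕ) (f : κ → Fin N) :
    rowMonomial r f = MvPolynomial.monomial (rowExponent r f) 1 := by
  rw [rowExponent, MvPolynomial.monomial_sum_one]
  rfl

theorem rowExponent_apply (r : κ → ℕ) (f : κ → Fin N) (x : ℕ × Fin N) :
    rowExponent r f x = Fintype.card {k // (r k, f k) = x} := by
  classical
  rw [rowExponent, Finsupp.finsetSum_apply, Fintype.card_subtype, Finset.card_filter]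
  simp only [Finsupp.single_apply]

/-- The linear map `(ℂ^N)^{⊗κ} → ℂ[X]` sending the basis tensor of a colouring `f` to the monomial
`∏ₖ X (r k, f k)`. It identifies the coinvariants of the row group with polynomials. -/
noncomputable def rowPoly (N : ℕ) (r : κ → ℕ) :
    (PiTensorProduct ℂ fun _ : κ => (Fin N → ℂ)) →ₗ[ℂ] MvPolynomial (ℕ × Fin N) ℂ :=
  (tensorBasis κ N).constr ℂ (rowMonomial r)

theorem rowPoly_tensorBasis (r : κ → ℕ) (f : κ → Fin N) :
    rowPoly N r (tensorBasis κ N f) = rowMonomial r f :=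
  (tensorBasis κ N).constr_basis ℂ _ f

theorem rowMonomial_comp_symm (r : κ → ℕ) (f : κ → Fin N) (σ : Perm κ) :
    rowMonomial r (f ∘ σ.symm) = ∏ k, MvPolynomial.X (r (σ k), f k) := by
  rw [rowMonomial, ← Equiv.prod_comp σ]
  simp

variable [DecidableEq κ]

theorem exists_perm_of_rowExponent_eq {r : κ → ℕ} {f g : κ → Fin N}
    (h : rowExponent r f = rowExponent r g) : ∃ p ∈ fiberPerms r, f ∘ p = g := by
  have e : ∀ x, {k // (r k, g k) = x} ≃ {k // (r k, f k) = x} := fun x =>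
    Fintype.equivOfCardEq (by rw [← rowExponent_apply, ← rowExponent_apply, h])
  have h1 : ∀ k, (r (ofFiberEquiv e k), f (ofFiberEquiv e k)) = (r k, g k) :=
    fun k => ofFiberEquiv_map (f := fun k => (r k, g k)) (g := fun k => (r k, f k)) e k
  exact ⟨ofFiberEquiv e, mem_fiberPerms.2 fun k => congrArg Prod.fst (h1 k),
    funext fun k => congrArg Prod.snd (h1 k)⟩

theorem rowPoly_comp_rowOp (r : κ → ℕ) :
    rowPoly N r ∘ₗ rowOp (tensorRep κ (Fin N → ℂ)) r =
      ((fiberPerms r).card : ℂ) • rowPoly N r := by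
  refine (tensorBasis κ N).ext fun f => ?_
  rw [LinearMap.comp_apply, rowOp, LinearMap.sum_apply, map_sum, LinearMap.smul_apply,
    rowPoly_tensorBasis]
  have : ∀ p ∈ fiberPerms r,
      rowPoly N r (tensorRep κ (Fin N → ℂ) p (tensorBasis κ N f)) = rowMonomial r f := by
    intro p hp
    rw [tensorRep_tensorBasis, rowPoly_tensorBasis, rowMonomial_comp_symm]
    exact Finset.prod_congr rfl fun k _ => by rw [mem_fiberPerms.1 hp k]
  rw [Finset.sum_congr rfl this, Finset.sum_const, Nat.cast_smul_eq_nsmul]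

open scoped Classical in
/-- Symmetrizing along rows and passing to polynomials lose the same information. -/
theorem ker_rowPoly (r : κ → ℕ) :
    LinearMap.ker (rowPoly N r) = LinearMap.ker (rowOp (tensorRep κ (Fin N → ℂ)) r) := by
  apply le_antisymm
  · -- symmetrized basis tensors only depend on the monomial, so the symmetrizer factors
    let a := rowOp (tensorRep κ (Fin N → ℂ)) r
    let Ψ : MvPolynomial (ℕ × Fin N) ℂ →ₗ[ℂ] PiTensorProduct ℂ fun _ : κ => (Fin N → ℂ) :=
      (MvPolynomial.basisMonomials (ℕ × Fin N) ℂ).constr ℂ fun m =>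
        if h : ∃ f : κ → Fin N, rowExponent r f = m then a (tensorBasis κ N h.choose) else 0
    have hΨ : Ψ ∘ₗ rowPoly N r = a := by
      refine (tensorBasis κ N).ext fun f => ?_
      have hf : ∃ g : κ → Fin N, rowExponent r g = rowExponent r f := ⟨f, rfl⟩
      have h0 : MvPolynomial.monomial (rowExponent r f) (1 : ℂ) =
          MvPolynomial.basisMonomials (ℕ × Fin N) ℂ (rowExponent r f) := by
        rw [MvPolynomial.coe_basisMonomials]
      rw [LinearMap.comp_apply, rowPoly_tensorBasis, rowMonomial_eq_monomial, h0,
        (MvPolynomial.basisMonomials (ℕ × Fin N) ℂ).constr_basis ℂ, dif_pos hf]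
      obtain ⟨p, hp, hpf⟩ := exists_perm_of_rowExponent_eq hf.choose_spec
      have h1 : a * tensorRep κ (Fin N → ℂ) p⁻¹ = a := rowOp_mul _ (inv_mem_fiberPerms hp)
      have h2 : tensorBasis κ N f = tensorRep κ (Fin N → ℂ) p⁻¹ (tensorBasis κ N hf.choose) := by
        rw [tensorRep_tensorBasis]
        exact congrArg _ hpf.symm
      rw [h2, ← Module.End.mul_apply, h1]
    intro x hx
    rw [LinearMap.mem_ker] at hx ⊢
    change a x = 0
    rw [← hΨ, LinearMap.comp_apply, hx, map_zero]
  · intro x hx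
    rw [LinearMap.mem_ker] at hx ⊢
    have h1 := LinearMap.congr_fun (rowPoly_comp_rowOp (N := N) r) x
    rw [LinearMap.comp_apply, hx, map_zero, LinearMap.smul_apply] at h1
    refine (smul_eq_zero.1 h1.symm).resolve_left ?_
    exact_mod_cast (Finset.card_pos.2 ⟨1, one_mem_fiberPerms⟩).ne'

/-- The bideterminant of a colouring `f`: the product over the columns of the minors of the
generic matrix with the rows of that column and the colours of its boxes. -/
noncomputable def bideterminant (r c : κ → ℕ) (f : κ → Fin N) : MvPolynomial (ℕ × Fin N) ℂ :=
  ∑ q ∈ fiberPerms c, ((Perm.sign q : ℤ) : ℂ) • ∏ k, MvPolynomial.X (r (q k), f k)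

theorem rowPoly_colOp (r c : κ → ℕ) (f : κ → Fin N) :
    rowPoly N r (colOp (tensorRep κ (Fin N → ℂ)) c (tensorBasis κ N f)) = bideterminant r c f := by
  rw [colOp, LinearMap.sum_apply, map_sum, bideterminant]
  refine Finset.sum_congr rfl fun q _ => ?_
  rw [LinearMap.smul_apply, map_smul, tensorRep_tensorBasis, rowPoly_tensorBasis,
    rowMonomial_comp_symm]

/-- The image of the Young symmetrizer is isomorphic to the span of the bideterminants. -/
theorem youngRank_eq_finrank_span (N : ℕ) (r c : κ → ℕ) :
    youngRank N r c =
      Module.finrank ℂ (Submodule.span ℂ (Set.range (bideterminant (N := N) r c))) := by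
  have : FiniteDimensional ℂ (PiTensorProduct ℂ fun _ : κ => (Fin N → ℂ)) :=
    Module.Finite.of_basis (tensorBasis κ N)
  set a := rowOp (tensorRep κ (Fin N → ℂ)) r
  set b := colOp (tensorRep κ (Fin N → ℂ)) c
  have h1 : LinearMap.range (rowPoly N r ∘ₗ b) =
      Submodule.span ℂ (Set.range (bideterminant (N := N) r c)) := by
    rw [LinearMap.range_eq_map, ← (tensorBasis κ N).span_eq, Submodule.map_span, ← Set.range_comp]
    congr 2
    funext f
    exact rowPoly_colOp r c f
  have h2 : LinearMap.ker (rowPoly N r ∘ₗ b) = LinearMap.ker (a ∘ₗ b) := by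
    rw [LinearMap.ker_comp, LinearMap.ker_comp, ker_rowPoly]
  have h3 := LinearMap.finrank_range_add_finrank_ker (rowPoly N r ∘ₗ b)
  have h4 := LinearMap.finrank_range_add_finrank_ker (a ∘ₗ b)
  rw [← h1, youngRank]
  rw [h2] at h3
  change Module.finrank ℂ (LinearMap.range (a ∘ₗ b)) = _
  omega

end RowMonomial

section Strip

/-- If `α` is a full column and `β` consists of the other columns, a column permutation is a
permutation of `α` together with a column permutation of `β`. -/
theorem sum_fiberPerms_sum {α β M : Type*} [Fintype α] [DecidableEq α] [Fintype β]
    [DecidableEq β] [AddCommMonoid M] (c : β → ℕ) (G : Perm (α ⊕ β) → M) :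
    ∑ σ ∈ fiberPerms (Sum.elim (fun _ : α => 0) fun k => c k + 1), G σ =
      ∑ s : Perm α, ∑ q ∈ fiberPerms c, G (Equiv.sumCongr s q) := by
  rw [← Finset.sum_product']
  symm
  refine Finset.sum_bij (fun a _ => Equiv.sumCongr a.1 a.2) ?_ ?_ ?_ ?_
  · rintro ⟨s, q⟩ h
    rw [Finset.mem_product] at h
    rw [mem_fiberPerms]
    rintro (k | k)
    · rfl
    · simpa using mem_fiberPerms.1 h.2 k
  · rintro ⟨s, q⟩ _ ⟨s', q'⟩ _ h
    exact Perm.sumCongrHom_injective h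
  · intro σ hσ
    rw [mem_fiberPerms] at hσ
    have h1 : Set.MapsTo σ (Set.range Sum.inl) (Set.range Sum.inl) := by
      rintro _ ⟨k, rfl⟩
      have := hσ (Sum.inl k)
      rcases hx : σ (Sum.inl k) with y | y
      · exact ⟨y, rfl⟩
      · rw [hx] at this
        simp at this
    obtain ⟨⟨s, q⟩, hsq⟩ := Perm.mem_sumCongrHom_range_of_perm_mapsTo_inl h1
    refine ⟨⟨s, q⟩, ?_, hsq⟩
    rw [Finset.mem_product]
    refine ⟨Finset.mem_univ _, mem_fiberPerms.2 fun k => ?_⟩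
    have := hσ (Sum.inr k)
    rw [← hsq] at this
    simpa using this
  · intro a _
    rfl

/-- The generic square matrix. -/
noncomputable def genericMatrix (l : ℕ) : Matrix (Fin l) (Fin l) (MvPolynomial (ℕ × Fin l) ℂ) :=
  Matrix.of fun i j => MvPolynomial.X (i.val, j)

theorem det_genericMatrix_ne_zero (l : ℕ) : (genericMatrix l).det ≠ 0 := by
  intro h
  have h1 : genericMatrix l = (Matrix.mvPolynomialX (Fin l) (Fin l) ℂ).map
      (MvPolynomial.rename fun x => (x.1.val, x.2)) := by
    ext1 i j
    simp [genericMatrix]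
  have h2 : Function.Injective fun x : Fin l × Fin l => (x.1.val, x.2) := by
    rintro ⟨i, j⟩ ⟨i', j'⟩ h
    simp only [Prod.mk.injEq] at h
    exact Prod.ext (Fin.ext h.1) h.2
  rw [h1, ← AlgHom.mapMatrix_apply, ← AlgHom.map_det] at h
  exact Matrix.det_mvPolynomialX_ne_zero (Fin l) ℂ
    ((map_eq_zero_iff _ (MvPolynomial.rename_injective _ h2)).1 h)

variable {β : Type} [Fintype β] [DecidableEq β]

theorem bideterminant_sum (l : ℕ) (r c : β → ℕ) (f : Fin l ⊕ β → Fin l) :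
    bideterminant (Sum.elim (fun i : Fin l => i.val) r) (Sum.elim (fun _ => 0) fun k => c k + 1) f =
      ((genericMatrix l).submatrix id (f ∘ Sum.inl)).det * bideterminant r c (f ∘ Sum.inr) := by
  rw [bideterminant, sum_fiberPerms_sum, bideterminant, Matrix.det_apply, Finset.sum_mul_sum]
  refine Finset.sum_congr rfl fun s _ => Finset.sum_congr rfl fun q _ => ?_
  rw [Perm.sign_sumCongr, Fintype.prod_sum_type, mul_smul_comm, Units.smul_def,
    ← Int.cast_smul_eq_zsmul ℂ, smul_mul_assoc, smul_smul, Units.val_mul, Int.cast_mul,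
    mul_comm ((Perm.sign s : ℤ) : ℂ)]
  rfl

theorem det_submatrix_eq_smul (l : ℕ) (g : Fin l → Fin l) :
    ∃ z : ℂ, ((genericMatrix l).submatrix id g).det = z • (genericMatrix l).det := by
  by_cases hg : Function.Injective g
  · let σ : Perm (Fin l) := Equiv.ofBijective g hg.bijective_of_finite
    refine ⟨((Perm.sign σ : ℤ) : ℂ), ?_⟩
    have h := Matrix.det_permute' σ (genericMatrix l)
    rw [Int.cast_smul_eq_zsmul, zsmul_eq_mul, ← h]
    rfl
  · rw [Function.Injective] at hg
    push Not at hg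
    obtain ⟨i, j, hij, hne⟩ := hg
    refine ⟨0, ?_⟩
    rw [zero_smul]
    exact Matrix.det_zero_of_column_eq hne fun k => by simp [hij]

/-- On `ℂ^l`, a column of length `l` contributes only a determinant factor. -/
theorem youngRank_strip (l : ℕ) (r c : β → ℕ) :
    youngRank l (Sum.elim (fun i : Fin l => i.val) r) (Sum.elim (fun _ => 0) fun k => c k + 1) =
      youngRank l r c := by
  rw [youngRank_eq_finrank_span, youngRank_eq_finrank_span]
  set D := (genericMatrix l).det
  have hinj : Function.Injective (LinearMap.mulLeft ℂ D) := by
    intro x y hxy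
    exact mul_left_cancel₀ (det_genericMatrix_ne_zero l) hxy
  rw [((Submodule.span ℂ (Set.range (bideterminant (N := l) r c))).equivMapOfInjective
    _ hinj).finrank_eq, Submodule.map_span]
  refine congrArg (fun S : Submodule ℂ (MvPolynomial (ℕ × Fin l) ℂ) => Module.finrank ℂ S) ?_
  apply le_antisymm <;> rw [Submodule.span_le]
  · rintro _ ⟨f, rfl⟩
    obtain ⟨z, hz⟩ := det_submatrix_eq_smul l (f ∘ Sum.inl)
    rw [bideterminant_sum, hz, smul_mul_assoc]
    exact Submodule.smul_mem _ _ (Submodule.subset_span ⟨_, ⟨_, rfl⟩, rfl⟩)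
  · rintro _ ⟨_, ⟨f, rfl⟩, rfl⟩
    refine Submodule.subset_span ⟨Sum.elim id f, ?_⟩
    rw [bideterminant_sum]
    rfl

end Strip

/-! ### The hook content formula -/

theorem youngRank_equiv {κ κ' : Type} [Fintype κ] [DecidableEq κ] [Fintype κ'] [DecidableEq κ']
    (N : ℕ) (e : κ' ≃ κ) (r c : κ → ℕ) : youngRank N (r ∘ e) (c ∘ e) = youngRank N r c := by
  rw [youngRank_eq_finrank_span, youngRank_eq_finrank_span]
  have h : ∀ f : κ → Fin N, bideterminant (r ∘ e) (c ∘ e) (f ∘ e) = bideterminant r c f := by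
    intro f
    rw [bideterminant, bideterminant, ← sum_fiberPerms_equiv e]
    refine Finset.sum_congr rfl fun q _ => ?_
    rw [Perm.sign_permCongr, ← Equiv.prod_comp e]
    simp
  have h' : Set.range (bideterminant (N := N) (r ∘ e) (c ∘ e)) =
      Set.range (bideterminant (N := N) r c) := by
    rw [← (e.arrowCongr (Equiv.refl (Fin N))).symm.surjective.range_comp
      (bideterminant (r ∘ e) (c ∘ e))]
    exact congrArg Set.range (funext h)
  rw [h']

@[to_additive]
theorem prod_cells_eq {M : Type*} [CommMonoid M] (μ : YoungDiagram) (l : ℕ)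
    (hl : ∀ i, l ≤ i → μ.rowLen i = 0) (g : ℕ × ℕ → M) :
    ∏ x ∈ μ.cells, g x = ∏ i ∈ Finset.range l, ∏ j ∈ Finset.range (μ.rowLen i), g (i, j) := by
  refine Finset.prod_finset_product _ _ _ ?_
  rintro ⟨i, j⟩
  simp only [YoungDiagram.mem_cells, Finset.mem_range, YoungDiagram.mem_iff_lt_rowLen]
  refine ⟨fun h => ⟨?_, h⟩, fun h => h.2⟩
  by_contra hi
  have := hl i (by omega)
  omega

theorem rowLen_eq_zero_of_colLen_le (μ : YoungDiagram) {l i : ℕ} (hl : μ.colLen 0 ≤ l)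
    (hi : l ≤ i) : μ.rowLen i = 0 := by
  by_contra h
  have := YoungDiagram.mem_iff_lt_colLen.1 (YoungDiagram.mem_iff_lt_rowLen.2 (Nat.pos_of_ne_zero h))
  omega

/-- The diagram obtained by removing the first column. -/
def removeFirstCol (μ : YoungDiagram) : YoungDiagram where
  cells := (μ.cells.filter fun x => 0 < x.2).image fun x => (x.1, x.2 - 1)
  isLowerSet := by
    rintro ⟨i', j'⟩ ⟨i, j⟩ ⟨hi, hj⟩ h
    simp only [Finset.coe_image, Finset.coe_filter, Set.mem_image, Prod.exists, Set.mem_ofPred_eq,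
      YoungDiagram.mem_cells, Prod.mk.injEq] at h ⊢
    obtain ⟨a, b, ⟨hab, hb⟩, rfl, rfl⟩ := h
    simp only at hi hj
    exact ⟨i, j + 1, ⟨μ.up_left_mem hi (by omega) hab, by omega⟩, rfl, by omega⟩

theorem mem_removeFirstCol {μ : YoungDiagram} {i j : ℕ} :
    (i, j) ∈ removeFirstCol μ ↔ (i, j + 1) ∈ μ := by
  rw [← YoungDiagram.mem_cells, removeFirstCol]
  simp only [Finset.mem_image, Finset.mem_filter, Prod.exists, YoungDiagram.mem_cells,
    Prod.mk.injEq]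
  constructor
  · rintro ⟨a, b, ⟨hab, hb⟩, rfl, rfl⟩
    rwa [Nat.sub_add_cancel hb]
  · intro h
    exact ⟨i, j + 1, ⟨h, by omega⟩, rfl, by omega⟩

theorem rowLen_removeFirstCol (μ : YoungDiagram) (i : ℕ) :
    (removeFirstCol μ).rowLen i = μ.rowLen i - 1 := by
  have h : ∀ j, j < (removeFirstCol μ).rowLen i ↔ j + 1 < μ.rowLen i := fun j => by
    rw [← YoungDiagram.mem_iff_lt_rowLen, ← YoungDiagram.mem_iff_lt_rowLen, mem_removeFirstCol]
  have h1 := h ((removeFirstCol μ).rowLen i)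
  have h2 := h (μ.rowLen i - 1)
  have h3 := h (μ.rowLen i - 2)
  omega

theorem colLen_removeFirstCol (μ : YoungDiagram) (j : ℕ) :
    (removeFirstCol μ).colLen j = μ.colLen (j + 1) := by
  have h : ∀ i, i < (removeFirstCol μ).colLen j ↔ i < μ.colLen (j + 1) := fun i => by
    rw [← YoungDiagram.mem_iff_lt_colLen, ← YoungDiagram.mem_iff_lt_colLen, mem_removeFirstCol]
  exact eq_of_forall_lt_iff h

/-- The boxes of a diagram are those of its first column and those of the remaining diagram. -/
def removeFirstColEquiv (μ : YoungDiagram) :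
    Fin (μ.colLen 0) ⊕ (removeFirstCol μ).cells ≃ μ.cells where
  toFun := Sum.elim (fun i => ⟨(i, 0), YoungDiagram.mem_iff_lt_colLen.2 i.2⟩)
    fun k => ⟨(k.1.1, k.1.2 + 1), mem_removeFirstCol.1 k.2⟩
  invFun k := if h : k.1.2 = 0 then Sum.inl ⟨k.1.1, YoungDiagram.mem_iff_lt_colLen.1 (by
      have := k.2
      rwa [YoungDiagram.mem_cells, ← Prod.eta k.1, h] at this)⟩
    else Sum.inr ⟨(k.1.1, k.1.2 - 1), by
      rw [YoungDiagram.mem_cells, mem_removeFirstCol, Nat.sub_add_cancel (by omega)]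
      exact k.2⟩
  left_inv := by
    rintro (i | k) <;> simp
  right_inv := by
    rintro ⟨⟨i, _ | j⟩, h⟩ <;> simp

theorem youngRank_removeFirstCol (μ : YoungDiagram) :
    youngRank (μ.colLen 0) (boxRow μ) (boxCol μ) =
      youngRank (μ.colLen 0) (boxRow (removeFirstCol μ)) (boxCol (removeFirstCol μ)) := by
  rw [← youngRank_strip _ (boxRow (removeFirstCol μ)), ← youngRank_equiv _ (removeFirstColEquiv μ)]
  congr 1
  · ext (i | k) <;> rfl
  · ext (i | k) <;> rfl

/-- The hook length of a box. -/
def hookLength (μ : YoungDiagram) (x : ℕ × ℕ) : ℤ :=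
  (μ.rowLen x.1 - x.2 : ℤ) + (μ.colLen x.2 - x.1 : ℤ) - 1

/-- The content polynomial of a diagram, evaluated at `N`. -/
def contentProd (μ : YoungDiagram) (N : ℕ) : ℤ :=
  ∏ x ∈ μ.cells, ((N : ℤ) + x.2 - x.1)

theorem youngScalar_mul_youngRank_eq_contentProd (μ : YoungDiagram) (N : ℕ) :
    youngScalar (boxRow μ) (boxCol μ) * (youngRank N (boxRow μ) (boxCol μ) : ℤ) =
      contentProd μ N := by
  have h := isBoxSet_youngDiagram μ
  rw [youngScalar_mul_youngRank N h h.youngScalar_ne_zero, h.youngTrace_eq_prod, contentProd]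
  exact Finset.prod_coe_sort μ.cells fun x => (N : ℤ) + x.2 - x.1

/-- At `N` the length of the first column, the content products of a diagram and of the diagram
without its first column have the same ratio as the hook products. -/
theorem prod_hookLength_mul_contentProd (μ : YoungDiagram) :
    (∏ x ∈ (removeFirstCol μ).cells, hookLength (removeFirstCol μ) x) *
        contentProd μ (μ.colLen 0) =
      (∏ x ∈ μ.cells, hookLength μ x) * contentProd (removeFirstCol μ) (μ.colLen 0) := by
  have hcol : (removeFirstCol μ).colLen 0 ≤ μ.colLen 0 := by
    rw [colLen_removeFirstCol]
    exact μ.colLen_anti _ _ (Nat.zero_le _)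
  simp only [contentProd, prod_cells_eq _ _ fun _ => rowLen_eq_zero_of_colLen_le _ hcol,
    prod_cells_eq μ _ fun _ => rowLen_eq_zero_of_colLen_le _ le_rfl, rowLen_removeFirstCol,
    ← Finset.prod_mul_distrib]
  refine Finset.prod_congr rfl fun i hi => ?_
  rw [Finset.mem_range, ← YoungDiagram.mem_iff_lt_colLen, YoungDiagram.mem_iff_lt_rowLen] at hi
  obtain ⟨m, hm⟩ : ∃ m, μ.rowLen i = m + 1 := ⟨μ.rowLen i - 1, by omega⟩
  rw [hm, Finset.prod_range_succ, Finset.prod_range_succ', Nat.add_sub_cancel]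
  have h1 : ∀ j ∈ Finset.range m,
      hookLength (removeFirstCol μ) (i, j) = hookLength μ (i, j + 1) := by
    intro j _
    simp only [hookLength, rowLen_removeFirstCol, colLen_removeFirstCol, hm]
    push_cast
    ring
  rw [Finset.prod_congr rfl h1]
  -- the last box of row `i` has content factor equal to the hook length of the first box
  have h2 : hookLength μ (i, 0) = (μ.colLen 0 : ℤ) + m - i := by
    simp only [hookLength, hm]
    push_cast
    ring
  rw [h2]
  ring

theorem contentProd_ne_zero (μ : YoungDiagram) (N : ℕ) (h : μ.colLen 0 ≤ N) :
    contentProd μ N ≠ 0 := by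
  rw [contentProd, Finset.prod_ne_zero_iff]
  rintro ⟨i, j⟩ hx
  have h1 := YoungDiagram.mem_iff_lt_colLen.1 (μ.up_left_mem le_rfl (Nat.zero_le j) hx)
  simp only
  omega

/-- The scalar by which the Young symmetrizer fails to be idempotent is the product of the hook
lengths. -/
theorem youngScalar_eq_prod_hookLength (μ : YoungDiagram) :
    youngScalar (boxRow μ) (boxCol μ) = ∏ x ∈ μ.cells, hookLength μ x := by
  obtain ⟨n, hn⟩ : ∃ n, μ.rowLen 0 = n := ⟨_, rfl⟩
  induction n generalizing μ with
  | zero =>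
    have hμ : μ.cells = ∅ := by
      refine Finset.eq_empty_of_forall_notMem ?_
      rintro ⟨i, j⟩ hx
      have := YoungDiagram.mem_iff_lt_rowLen.1 (μ.up_left_mem (Nat.zero_le i) le_rfl hx)
      omega
    have h := youngScalar_mul_youngRank_eq_contentProd μ 0
    have hc : contentProd μ 0 = 1 := by rw [contentProd, hμ, Finset.prod_empty]
    have hh : ∏ x ∈ μ.cells, hookLength μ x = 1 := by rw [hμ, Finset.prod_empty]
    rw [hc] at h
    rw [hh]
    -- the scalar is a unit, and it is positive because the rank is
    rcases Int.eq_one_or_neg_one_of_mul_eq_one h with h1 | h1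
    · exact h1
    · rw [h1] at h
      omega
  | succ n ih =>
    have ih' := ih (removeFirstCol μ) (by rw [rowLen_removeFirstCol, hn]; rfl)
    have h1 := youngScalar_mul_youngRank_eq_contentProd μ (μ.colLen 0)
    have h2 := youngScalar_mul_youngRank_eq_contentProd (removeFirstCol μ) (μ.colLen 0)
    have h3 := prod_hookLength_mul_contentProd μ
    have h4 := contentProd_ne_zero (removeFirstCol μ) (μ.colLen 0) (by
      rw [colLen_removeFirstCol]
      exact μ.colLen_anti _ _ (Nat.zero_le _))
    rw [youngRank_removeFirstCol] at h1
    rw [ih'] at h2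
    rw [← h2, ← h1] at h3
    rw [← h2] at h4
    refine mul_right_cancel₀ h4 ?_
    linear_combination h3

/-- The hook content formula for the dimension of a Schur functor. -/
theorem finrank_schurFunctor_mul_prod_hookLength (μ : YoungDiagram) (N : ℕ) :
    (Module.finrank ℂ (schurFunctor μ (Fin N → ℂ)) : ℤ) * ∏ x ∈ μ.cells, hookLength μ x =
      contentProd μ N := by
  rw [finrank_schurFunctor, ← youngScalar_eq_prod_hookLength, mul_comm,
    youngScalar_mul_youngRank_eq_contentProd]

/-! ### Partial fraction identities -/

section Identities

open Finset Nat

theorem prod_erase_sub (m q : ℕ) (hq : q ≤ m) :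
    ∏ i ∈ (range (m + 1)).erase q, ((i : ℚ) - q) = (-1) ^ q * q ! * (m - q)! := by
  obtain ⟨d, rfl⟩ := Nat.exists_eq_add_of_le hq
  have h1 : ∏ i ∈ (range (q + d + 1)).erase q, ((i : ℚ) - q) =
      (∏ i ∈ range q, ((i : ℚ) - q)) * ∏ i ∈ range d, ((i : ℚ) + 1) := by
    have h2 : ∀ i ∈ (range (q + d + 1)).erase q, ((i : ℚ) - q) = if i = q then 1 else (i : ℚ) - q :=
      fun i hi => by rw [if_neg (mem_erase.1 hi).1]
    rw [prod_congr rfl h2, prod_erase _ (by simp), add_assoc, prod_range_add, prod_range_succ']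
    congr 1
    · exact prod_congr rfl fun i hi => by rw [if_neg (mem_range.1 hi).ne]
    · rw [add_zero, if_pos rfl, mul_one]
      refine prod_congr rfl fun i _ => ?_
      rw [if_neg (by omega)]
      push_cast
      ring
  have h3 : ∏ i ∈ range d, ((i : ℚ) + 1) = d ! := by
    rw [← prod_range_add_one_eq_factorial]
    push_cast
    rfl
  have h4 : ∏ i ∈ range q, ((i : ℚ) - q) = (-1) ^ q * q ! := by
    have h5 : ((-1 : ℚ)) ^ q = ∏ _i ∈ range q, (-1 : ℚ) := by simp
    rw [← prod_range_reflect, ← prod_range_add_one_eq_factorial, h5]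
    push_cast
    rw [← prod_mul_distrib]
    refine prod_congr rfl fun i hi => ?_
    rw [mem_range] at hi
    rw [Nat.sub_sub, Nat.cast_sub (by omega)]
    push_cast
    ring
  rw [h1, h3, h4, Nat.add_sub_cancel_left]

/-- The partial fraction expansion of `F(z) / (z (z + 1) ⋯ (z + m))`, evaluated at `z = p + 1`. -/
theorem sum_partialFraction (m p : ℕ) (F : Polynomial ℚ) (hF : F.natDegree ≤ m) :
    ∑ q ∈ range (m + 1), F.eval (-(q : ℚ)) / ((-1) ^ q * q ! * (m - q)!) / (p + 1 + q) =
      F.eval ((p : ℚ) + 1) * p ! / (p + 1 + m)! := by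
  have hinj : Set.InjOn (fun i : ℕ => -(i : ℚ)) (range (m + 1)) := by
    intro i _ j _ h
    simpa using h
  have h1 := Lagrange.eq_interpolate (f := F) hinj (by
    rw [card_range]
    exact (Polynomial.degree_le_of_natDegree_le hF).trans_lt (by exact_mod_cast Nat.lt_succ_self m))
  have hpos : ∀ q : ℕ, (p : ℚ) + 1 + q ≠ 0 := fun q => by positivity
  have h2 := congrArg (Polynomial.eval ((p : ℚ) + 1)) h1
  rw [Lagrange.eval_interpolate_not_at_node _ (fun i _ h => hpos i (by rw [h]; ring)),
    Lagrange.eval_nodal] at h2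
  have h3 : (∏ i ∈ range (m + 1), ((p : ℚ) + 1 - -(i : ℚ))) * p ! = (p + 1 + m)! := by
    rw [add_assoc, add_comm 1 m, ← factorial_mul_ascFactorial, ascFactorial_eq_prod_range]
    push_cast
    rw [mul_comm]
    simp
  have h4 : ∀ q ∈ range (m + 1), Lagrange.nodalWeight (range (m + 1)) (fun i : ℕ => -(i : ℚ)) q *
      ((p : ℚ) + 1 - -(q : ℚ))⁻¹ * F.eval (-(q : ℚ)) =
      F.eval (-(q : ℚ)) / ((-1) ^ q * q ! * (m - q)!) / (p + 1 + q) := by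
    intro q hq
    rw [mem_range] at hq
    rw [← prod_erase_sub m q (by omega), Lagrange.nodalWeight, prod_inv_distrib]
    have h5 : ∏ j ∈ (range (m + 1)).erase q, (-(q : ℚ) - -(j : ℚ)) =
        ∏ j ∈ (range (m + 1)).erase q, ((j : ℚ) - q) := prod_congr rfl fun j _ => by ring
    rw [h5, sub_neg_eq_add, div_eq_mul_inv, div_eq_mul_inv]
    ring
  rw [sum_congr rfl h4] at h2
  have h5 : ((p + 1 + m)! : ℚ) ≠ 0 := by positivity
  rw [h2, eq_div_iff h5, ← h3]
  ring

/-- The coefficients of the shifted Legendre polynomials, up to sign. -/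
def legendreCoeff (m p : ℕ) : ℚ := m.choose p * (m + p).choose p

theorem legendreCoeff_mul_factorial {m p : ℕ} (h : p ≤ m) :
    legendreCoeff m p * (p ! ^ 2 * (m - p)!) = (m + p)! := by
  have h1 := Nat.choose_mul_factorial_mul_factorial h
  have h2 := Nat.add_choose_mul_factorial_mul_factorial m p
  have h1' : (m.choose p : ℚ) * p ! * (m - p)! = m ! := by exact_mod_cast h1
  have h2' : ((m + p).choose p : ℚ) * m ! * p ! = (m + p)! := by
    exact_mod_cast h2
  rw [legendreCoeff, ← h2', ← h1']
  ring

theorem prod_eq_legendreCoeff {m p : ℕ} (h : p ≤ m) :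
    ∏ j ∈ range p, (((m : ℚ) + 1 + j) * (m - j)) = legendreCoeff m p * p ! ^ 2 := by
  have h1 : ∏ j ∈ range p, ((m : ℚ) - j) = p ! * m.choose p := by
    rw [← Nat.cast_mul, ← descFactorial_eq_factorial_mul_choose, descFactorial_eq_prod_range]
    push_cast
    refine prod_congr rfl fun j hj => ?_
    rw [mem_range] at hj
    rw [Nat.cast_sub (by omega)]
  have h2 : ∏ j ∈ range p, ((m : ℚ) + 1 + j) = p ! * (m + p).choose p := by
    rw [← Nat.cast_mul, ← ascFactorial_eq_factorial_mul_choose, ascFactorial_eq_prod_range]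
    push_cast
    rfl
  rw [prod_mul_distrib, h1, h2, legendreCoeff]
  ring

theorem sum_neg_one_pow_mul_legendreCoeff (m : ℕ) :
    ∑ p ∈ range (m + 1), (-1) ^ p * legendreCoeff m p = (-1) ^ m := by
  have h := Polynomial.shiftedLegendre_eval_symm m (1 : ℚ)
  rw [sub_self] at h
  simp only [Polynomial.shiftedLegendre, map_sum, map_mul, one_pow,
    Polynomial.aeval_X_pow, Polynomial.aeval_C] at h
  rw [sum_range_succ' (fun k => _ * (0 : ℚ) ^ k)] at h
  simp at h
  rw [← h]
  refine sum_congr rfl fun p _ => ?_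
  rw [legendreCoeff, Nat.choose_symm_add, mul_assoc]

/-- The product of the linear factors `i - z`, for `i = 1, …, K`, with the factor of `p + 1`
omitted. -/
noncomputable def omittedProd (K p : ℕ) : Polynomial ℚ :=
  ∏ i ∈ (range K).erase p, (Polynomial.C ((i : ℚ) + 1) - Polynomial.X)

theorem natDegree_omittedProd_le {K p : ℕ} (hp : p < K) : (omittedProd K p).natDegree ≤ K - 1 := by
  refine (Polynomial.natDegree_prod_le _ _).trans ?_
  have h : ((range K).erase p).card = K - 1 := by
    rw [card_erase_of_mem (mem_range.2 hp), card_range]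
  rw [← h]
  refine (sum_le_card_nsmul _ _ 1 fun i _ => ?_).trans (by simp)
  refine (Polynomial.natDegree_sub_le _ _).trans ?_
  rw [Polynomial.natDegree_C, Polynomial.natDegree_X]
  simp

theorem eval_omittedProd_self {K p : ℕ} (hp : p ≤ K) :
    (omittedProd (K + 1) p).eval ((p : ℚ) + 1) = (-1) ^ p * p ! * (K - p)! := by
  rw [omittedProd, Polynomial.eval_prod, ← prod_erase_sub K p hp]
  refine prod_congr rfl fun i _ => ?_
  simp

theorem eval_omittedProd_neg {K p : ℕ} (hp : p < K) (q : ℕ) :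
    (omittedProd K p).eval (-(q : ℚ)) = (K + q)! / q ! / (p + 1 + q) := by
  have h1 : (p : ℚ) + 1 + q ≠ 0 := by positivity
  have h2 : (q ! : ℚ) ≠ 0 := by positivity
  rw [eq_div_iff h1, eq_div_iff h2, omittedProd, Polynomial.eval_prod]
  have h3 : (∏ i ∈ (range K).erase p,
      (Polynomial.C ((i : ℚ) + 1) - Polynomial.X).eval (-(q : ℚ))) * (p + 1 + q) =
      ∏ i ∈ range K, ((i : ℚ) + 1 + q) := by
    rw [← prod_erase_mul _ _ (mem_range.2 hp)]
    congr 1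
    exact prod_congr rfl fun i _ => by simp
  rw [h3, add_comm K q, ← factorial_mul_ascFactorial, ascFactorial_eq_prod_range]
  push_cast
  rw [mul_comm]
  congr 1
  exact prod_congr rfl fun i _ => by ring

/-- The double sum of the Legendre coefficients; the inner sum is a partial fraction expansion. -/
theorem sum_sum_legendreCoeff (m : ℕ) :
    ∑ p ∈ range m, ∑ q ∈ range m, ((-1) ^ (p + 1) * legendreCoeff m (p + 1)) *
      ((-1) ^ (q + 1) * legendreCoeff m (q + 1)) * (((p : ℚ) + 1) * (q + 1) /
        (p + 1 + (q + 1)) ^ 2) = (m : ℚ) := by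
  have key : ∀ p ∈ range m, ∑ q ∈ range m, ((-1) ^ (p + 1) * legendreCoeff m (p + 1)) *
      ((-1) ^ (q + 1) * legendreCoeff m (q + 1)) * (((p : ℚ) + 1) * (q + 1) /
        (p + 1 + (q + 1)) ^ 2) = 1 := by
    intro p hp
    rw [mem_range] at hp
    obtain ⟨K, rfl⟩ : ∃ K, m = K + 1 := ⟨m - 1, by omega⟩
    -- omitting the factor of `p + 1` produces the square of `p + 1 + q` in the denominator, and
    -- the factor `X` produces the numerator `q + 1`
    have h1 := sum_partialFraction (K + 1) p (Polynomial.X * omittedProd (K + 1) p) (by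
      refine Polynomial.natDegree_mul_le.trans ?_
      have := natDegree_omittedProd_le hp
      rw [Polynomial.natDegree_X]
      omega)
    rw [sum_range_succ'] at h1
    simp only [Polynomial.eval_mul, Polynomial.eval_X, eval_omittedProd_neg hp,
      eval_omittedProd_self (Nat.lt_succ_iff.1 hp), Nat.cast_zero, neg_zero, zero_mul, zero_div,
      add_zero] at h1
    have h2 : ∀ q ∈ range (K + 1), ((-1) ^ (p + 1) * legendreCoeff (K + 1) (p + 1)) *
        ((-1) ^ (q + 1) * legendreCoeff (K + 1) (q + 1)) * (((p : ℚ) + 1) * (q + 1) /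
        (p + 1 + (q + 1)) ^ 2) = (-((-1) ^ (p + 1) * legendreCoeff (K + 1) (p + 1) * (p + 1))) *
        (-((q + 1 : ℕ) : ℚ) * ((K + 1 + (q + 1))! / (q + 1)! / (p + 1 + (q + 1 : ℕ))) /
          ((-1) ^ (q + 1) * (q + 1)! * (K + 1 - (q + 1))!) / (p + 1 + (q + 1 : ℕ))) := by
      intro q hq
      rw [mem_range] at hq
      rw [← legendreCoeff_mul_factorial (show q + 1 ≤ K + 1 by omega)]
      have e1 : ((q + 1)! : ℚ) ≠ 0 := by positivity
      have e2 : ((K + 1 - (q + 1))! : ℚ) ≠ 0 := by positivity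
      have e3 : (p : ℚ) + 1 + (q + 1 : ℕ) ≠ 0 := by positivity
      have e4 : ((-1 : ℚ) ^ (q + 1)) * (-1) ^ (q + 1) = 1 := by
        rw [← mul_pow]; simp
      have e5 : ((-1 : ℚ) ^ (q + 1)) ≠ 0 := by simp
      push_cast at e3 ⊢
      field_simp
      linear_combination (legendreCoeff (K + 1) (p + 1) * legendreCoeff (K + 1) (q + 1)) * e4
    rw [sum_congr rfl h2, ← mul_sum, h1]
    have h3 := legendreCoeff_mul_factorial (show p + 1 ≤ K + 1 by omega)
    have h4 : ((K + 1 + (p + 1))! : ℚ) ≠ 0 := by positivity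
    have e4 : ((-1 : ℚ) ^ p) * (-1) ^ p = 1 := by
      rw [← mul_pow]; simp
    rw [show p + 1 + (K + 1) = K + 1 + (p + 1) by ring, mul_div_assoc', div_eq_one_iff_eq h4, ← h3,
      factorial_succ p, Nat.add_sub_add_right, pow_succ]
    push_cast
    linear_combination (legendreCoeff (K + 1) (p + 1) * (((p : ℚ) + 1) * p !) ^ 2 * (K - p)!) * e4
  rw [sum_congr rfl key]
  simp

/-- The product of the dimensions of the hook `(p + 1, 1^q)` and its conjugate on `ℂ^{n+1}` is
`hookCoeff n p * hookCoeff n q * ((n + 1) / (p + q + 1))²`. -/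
def hookCoeff (n p : ℕ) : ℚ := n.choose p * (n + 1 + p).choose p

theorem hookCoeff_mul_factorial {n p : ℕ} (h : p ≤ n) :
    (n + 1) * hookCoeff n p * (p ! ^ 2 * (n - p)!) = (n + 1 + p)! := by
  have h1 := Nat.choose_mul_factorial_mul_factorial h
  have h2 := Nat.add_choose_mul_factorial_mul_factorial (n + 1) p
  have h1' : (n.choose p : ℚ) * p ! * (n - p)! = n ! := by exact_mod_cast h1
  have h2' : ((n + 1 + p).choose p : ℚ) * (n + 1)! * p ! = (n + 1 + p)! := by
    exact_mod_cast h2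
  rw [hookCoeff, ← h2', factorial_succ, Nat.cast_mul, ← h1']
  push_cast
  ring

theorem prod_eq_hookCoeff {n p : ℕ} (h : p ≤ n) :
    ∏ j ∈ range p, (((n : ℚ) + 2 + j) * (n - j)) = hookCoeff n p * p ! ^ 2 := by
  have h1 : ∏ j ∈ range p, ((n : ℚ) - j) = p ! * n.choose p := by
    rw [← Nat.cast_mul, ← descFactorial_eq_factorial_mul_choose, descFactorial_eq_prod_range]
    push_cast
    refine prod_congr rfl fun j hj => ?_
    rw [mem_range] at hj
    rw [Nat.cast_sub (by omega)]
  have h2 : ∏ j ∈ range p, ((n : ℚ) + 2 + j) = p ! * (n + 1 + p).choose p := by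
    rw [← Nat.cast_mul, ← ascFactorial_eq_factorial_mul_choose, ascFactorial_eq_prod_range]
    push_cast
    exact prod_congr rfl fun j _ => by ring
  rw [prod_mul_distrib, h1, h2, hookCoeff]
  ring

theorem sum_sum_hookCoeff (n : ℕ) :
    ∑ p ∈ range (n + 1), ∑ q ∈ range (n + 1), ((-1) ^ p * hookCoeff n p) *
      ((-1) ^ q * hookCoeff n q) * (((n : ℚ) + 1) ^ 2 / (p + 1 + q) ^ 2) = (n : ℚ) + 1 := by
  have key : ∀ p ∈ range (n + 1), ∑ q ∈ range (n + 1), ((-1) ^ p * hookCoeff n p) *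
      ((-1) ^ q * hookCoeff n q) * (((n : ℚ) + 1) ^ 2 / (p + 1 + q) ^ 2) = 1 := by
    intro p hp
    rw [mem_range] at hp
    have h1 := sum_partialFraction n p (omittedProd (n + 1) p) (natDegree_omittedProd_le hp)
    simp only [eval_omittedProd_neg hp, eval_omittedProd_self (Nat.lt_succ_iff.1 hp)] at h1
    have h2 : ∀ q ∈ range (n + 1), ((-1) ^ p * hookCoeff n p) *
        ((-1) ^ q * hookCoeff n q) * (((n : ℚ) + 1) ^ 2 / (p + 1 + q) ^ 2) =
        ((-1) ^ p * ((n + 1) * hookCoeff n p)) * ((n + 1 + q)! / q ! / (p + 1 + q) /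
          ((-1) ^ q * q ! * (n - q)!) / (p + 1 + q)) := by
      intro q hq
      rw [mem_range] at hq
      rw [← hookCoeff_mul_factorial (show q ≤ n by omega)]
      have e1 : (q ! : ℚ) ≠ 0 := by positivity
      have e2 : ((n - q)! : ℚ) ≠ 0 := by positivity
      have e3 : (p : ℚ) + 1 + q ≠ 0 := by positivity
      have e4 : ((-1 : ℚ) ^ q) * (-1) ^ q = 1 := by
        rw [← mul_pow]; simp
      have e5 : ((-1 : ℚ) ^ q) ≠ 0 := by simp
      field_simp
      linear_combination (hookCoeff n p * hookCoeff n q) * e4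
    rw [sum_congr rfl h2, ← mul_sum, h1]
    have h3 := hookCoeff_mul_factorial (show p ≤ n by omega)
    have h4 : ((n + 1 + p)! : ℚ) ≠ 0 := by positivity
    have e4 : ((-1 : ℚ) ^ p) * (-1) ^ p = 1 := by
      rw [← mul_pow]; simp
    rw [show p + 1 + n = n + 1 + p by ring, mul_div_assoc', div_eq_one_iff_eq h4, ← h3]
    linear_combination (((n : ℚ) + 1) * hookCoeff n p * (p ! : ℚ) ^ 2 * (n - p)!) * e4
  rw [sum_congr rfl key]
  simp

end Identities

/-! ### Dimensions for the doubles of strict partitions with at most two rows -/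

open scoped Nat

theorem prod_transpose_cells {M : Type*} [CommMonoid M] (μ : YoungDiagram) (g : ℕ × ℕ → M) :
    ∏ x ∈ μ.transpose.cells, g x = ∏ x ∈ μ.cells, g x.swap := by
  symm
  refine Finset.prod_equiv (Equiv.prodComm ℕ ℕ) (fun x => ?_) (fun x _ => rfl)
  rw [YoungDiagram.mem_cells, YoungDiagram.mem_cells, YoungDiagram.mem_transpose]
  rfl

theorem prod_hookLength_transpose (μ : YoungDiagram) :
    ∏ x ∈ μ.transpose.cells, hookLength μ.transpose x = ∏ x ∈ μ.cells, hookLength μ x := by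
  rw [prod_transpose_cells]
  refine Finset.prod_congr rfl fun x _ => ?_
  simp only [hookLength, Prod.fst_swap, Prod.snd_swap, YoungDiagram.rowLen_transpose,
    YoungDiagram.colLen_transpose]
  ring

theorem prod_doubleCells {M : Type*} [CommMonoid M] (lam : YoungDiagram) (g : ℕ × ℕ → M) :
    ∏ x ∈ doubleCells lam, g x =
      ∏ y ∈ lam.cells, (g (y.1, y.1 + y.2 + 1) * g (y.1 + y.2, y.1)) := by
  rw [doubleCells, Finset.prod_union, Finset.prod_image, Finset.prod_image,
    Finset.prod_mul_distrib]
  · rintro ⟨a, b⟩ _ ⟨a', b'⟩ _ h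
    simp only [Prod.mk.injEq] at h ⊢
    omega
  · rintro ⟨a, b⟩ _ ⟨a', b'⟩ _ h
    simp only [Prod.mk.injEq] at h ⊢
    omega
  · rw [Finset.disjoint_left]
    rintro x h1 h2
    rw [Finset.mem_image] at h1 h2
    obtain ⟨a, -, rfl⟩ := h1
    obtain ⟨b, -, h⟩ := h2
    simp only [Prod.mk.injEq] at h
    omega

theorem contentProd_dPlus (lam : YoungDiagram) (h : IsStrictPartition lam) (N : ℕ) :
    (contentProd (dPlus lam h) N : ℚ) = ∏ y ∈ lam.cells, (((N : ℚ) + 1 + y.2) * (N - y.2)) := by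
  have h1 : (dPlus lam h).cells = doubleCells lam := rfl
  rw [contentProd, h1, prod_doubleCells]
  push_cast
  exact Finset.prod_congr rfl fun y _ => by ring

/-- Passing to the conjugate diagram amounts to lowering the dimension from `m + 1` to `m`. -/
theorem contentProd_dMinus (lam : YoungDiagram) (h : IsStrictPartition lam) (m : ℕ) :
    (contentProd (dMinus lam h) (m + 1) : ℚ) =
      ∏ y ∈ lam.cells, (((m : ℚ) + 1 + y.2) * (m - y.2)) := by
  have h1 : (dPlus lam h).cells = doubleCells lam := rfl
  rw [contentProd, dMinus, prod_transpose_cells, h1, prod_doubleCells]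
  push_cast
  refine Finset.prod_congr rfl fun y _ => ?_
  simp only [Prod.fst_swap, Prod.snd_swap]
  push_cast
  ring

theorem rowLen_eq_of_forall {μ : YoungDiagram} {i n : ℕ} (h : ∀ j, (i, j) ∈ μ ↔ j < n) :
    μ.rowLen i = n :=
  eq_of_forall_lt_iff fun j => by rw [← YoungDiagram.mem_iff_lt_rowLen, h]

theorem colLen_eq_of_forall {μ : YoungDiagram} {j n : ℕ} (h : ∀ i, (i, j) ∈ μ ↔ i < n) :
    μ.colLen j = n :=
  eq_of_forall_lt_iff fun i => by rw [← YoungDiagram.mem_iff_lt_colLen, h]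

theorem mem_dPlus {lam : YoungDiagram} (h : IsStrictPartition lam) (i j : ℕ) :
    (i, j) ∈ dPlus lam h ↔ (i < j ∧ j ≤ i + lam.rowLen i) ∨ (j ≤ i ∧ i < j + lam.rowLen j) :=
  mem_doubleCells i j

theorem prod_range_sub_eq_factorial (p : ℕ) :
    ∏ m ∈ Finset.range p, ((p : ℤ) - m) = p ! := by
  rw [← Finset.prod_range_reflect, ← Finset.prod_range_add_one_eq_factorial]
  push_cast
  refine Finset.prod_congr rfl fun m hm => ?_
  rw [Finset.mem_range] at hm
  rw [Nat.sub_sub, Nat.cast_sub (by omega)]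
  push_cast
  ring

/-- The product `(p + 1)! / (p + 1 - s)` of the numbers `1, …, p + 1` with `p + 1 - s` omitted. -/
theorem prod_range_skip (p s : ℕ) (hs : s ≤ p) :
    ((p : ℤ) + 1 - s) * ∏ m ∈ Finset.range p, ((p : ℤ) - m + if m < s then 1 else 0) =
      (p + 1)! := by
  induction s generalizing p with
  | zero =>
    simp [prod_range_sub_eq_factorial, Nat.factorial_succ]
  | succ s ih =>
    obtain ⟨p, rfl⟩ : ∃ p', p = p' + 1 := ⟨p - 1, by omega⟩
    rw [Finset.prod_range_succ', Nat.factorial_succ (p + 1), Nat.cast_mul, ← ih p (by omega)]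
    have h : ∀ m ∈ Finset.range p,
        ((p + 1 : ℕ) : ℤ) - (m + 1 : ℕ) + (if m + 1 < s + 1 then 1 else 0) =
          (p : ℤ) - m + if m < s then 1 else 0 := by
      intro m _
      simp
    rw [Finset.prod_congr rfl h]
    simp
    ring

/-- The double of a one-row partition is a hook. -/
theorem prod_hookLength_dPlus_one_row {lam : YoungDiagram} (h : IsStrictPartition lam) {p : ℕ}
    (hp : 0 < p) (hl : ∀ i, lam.rowLen i = if i = 0 then p else 0) :
    ∏ x ∈ (dPlus lam h).cells, hookLength (dPlus lam h) x = 2 * (p ! : ℤ) ^ 2 := by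
  obtain ⟨b, rfl⟩ : ∃ b, p = b + 1 := ⟨p - 1, by omega⟩
  have hrow : ∀ i, (dPlus lam h).rowLen i = if i = 0 then b + 2 else if i ≤ b then 1 else 0 := by
    intro i
    refine rowLen_eq_of_forall fun j => ?_
    rw [mem_dPlus, hl, hl]
    split_ifs <;> omega
  have hcol : ∀ j, (dPlus lam h).colLen j =
      if j = 0 then b + 1 else if j ≤ b + 1 then 1 else 0 := by
    intro j
    refine colLen_eq_of_forall fun i => ?_
    rw [mem_dPlus, hl, hl]
    split_ifs <;> omega
  have h1 : (dPlus lam h).cells = doubleCells lam := rfl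
  rw [h1, prod_doubleCells, prod_cells_eq lam 1 fun i hi => by rw [hl, if_neg (by omega)]]
  rw [Finset.prod_range_one, hl, if_pos rfl, Finset.prod_mul_distrib,
    Finset.prod_range_succ' (fun j => hookLength (dPlus lam h) (0 + j, 0))]
  have h2 : ∀ j ∈ Finset.range (b + 1),
      hookLength (dPlus lam h) (0, 0 + j + 1) = ((b + 1 : ℕ) : ℤ) - j := by
    intro j hj
    rw [Finset.mem_range] at hj
    simp only [hookLength, hrow, hcol]
    split_ifs <;> first | contradiction | exact absurd trivial ‹_› | omega
  have h3 : ∀ j ∈ Finset.range b, hookLength (dPlus lam h) (0 + (j + 1), 0) = (b : ℤ) - j := by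
    intro j hj
    rw [Finset.mem_range] at hj
    simp only [hookLength, hrow, hcol]
    split_ifs <;> first | contradiction | exact absurd trivial ‹_› | omega
  have h4 : hookLength (dPlus lam h) (0 + 0, 0) = 2 * (b + 1) := by
    simp only [hookLength, hrow, hcol]
    simp
    ring
  rw [Finset.prod_congr rfl h2, Finset.prod_congr rfl h3, h4, prod_range_sub_eq_factorial,
    prod_range_sub_eq_factorial, Nat.factorial_succ]
  push_cast
  ring

/-- The double of `(p, q)` consists of two nested hooks. Beyond the boxes next to the corner, the
hook lengths along the arm and along the leg of the outer hook skip the value `p - q`, hence the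
factor `(p - q)²`. -/
theorem prod_hookLength_dPlus_two_rows {lam : YoungDiagram} (h : IsStrictPartition lam) {p q : ℕ}
    (hq : 0 < q) (hqp : q < p)
    (hl : ∀ i, lam.rowLen i = if i = 0 then p else if i = 1 then q else 0) :
    (∏ x ∈ (dPlus lam h).cells, hookLength (dPlus lam h) x) * ((p : ℤ) - q) ^ 2 =
      4 * (p + q) ^ 2 * (p ! : ℤ) ^ 2 * (q ! : ℤ) ^ 2 := by
  obtain ⟨b, rfl⟩ : ∃ b, p = b + 2 := ⟨p - 2, by omega⟩
  obtain ⟨c, rfl⟩ : ∃ c, q = c + 1 := ⟨q - 1, by omega⟩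
  have hrow : ∀ i, (dPlus lam h).rowLen i = if i = 0 then b + 3 else if i = 1 then c + 3 else
      if i ≤ c + 1 then 2 else if i ≤ b + 1 then 1 else 0 := by
    intro i
    refine rowLen_eq_of_forall fun j => ?_
    rw [mem_dPlus, hl, hl]
    split_ifs <;> omega
  have hcol : ∀ j, (dPlus lam h).colLen j = if j = 0 then b + 2 else if j = 1 then c + 2 else
      if j ≤ c + 2 then 2 else if j ≤ b + 2 then 1 else 0 := by
    intro j
    refine colLen_eq_of_forall fun i => ?_
    rw [mem_dPlus, hl, hl]
    split_ifs <;> omega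
  have h1 : (dPlus lam h).cells = doubleCells lam := rfl
  rw [h1, prod_doubleCells, prod_cells_eq lam 2 fun i hi => by
    rw [hl, if_neg (by omega), if_neg (by omega)]]
  rw [Finset.prod_range_succ, Finset.prod_range_one, hl, hl, if_pos rfl, if_neg one_ne_zero,
    if_pos rfl, Finset.prod_mul_distrib, Finset.prod_mul_distrib,
    Finset.prod_range_succ' (fun j => hookLength (dPlus lam h) (0, 0 + j + 1)),
    Finset.prod_range_succ' (fun j => hookLength (dPlus lam h) (0 + j, 0)),
    Finset.prod_range_succ' (fun j => hookLength (dPlus lam h) (0 + (j + 1), 0)),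
    Finset.prod_range_succ' (fun j => hookLength (dPlus lam h) (1 + j, 1))]
  have h2 : ∀ j ∈ Finset.range (b + 1), hookLength (dPlus lam h) (0, 0 + (j + 1) + 1) =
      ((b + 1 : ℕ) : ℤ) - j + if j < c + 1 then 1 else 0 := by
    intro j hj
    rw [Finset.mem_range] at hj
    simp only [hookLength, hrow, hcol]
    split_ifs <;> first | contradiction | exact absurd trivial ‹_› | omega
  have h3 : ∀ j ∈ Finset.range b, hookLength (dPlus lam h) (0 + (j + 1 + 1), 0) =
      (b : ℤ) - j + if j < c then 1 else 0 := by
    intro j hj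
    rw [Finset.mem_range] at hj
    simp only [hookLength, hrow, hcol]
    split_ifs <;> first | contradiction | exact absurd trivial ‹_› | omega
  have h4 : ∀ j ∈ Finset.range (c + 1), hookLength (dPlus lam h) (1, 1 + j + 1) =
      ((c + 1 : ℕ) : ℤ) - j := by
    intro j hj
    rw [Finset.mem_range] at hj
    simp only [hookLength, hrow, hcol]
    split_ifs <;> first | contradiction | exact absurd trivial ‹_› | omega
  have h5 : ∀ j ∈ Finset.range c, hookLength (dPlus lam h) (1 + (j + 1), 1) = (c : ℤ) - j := by
    intro j hj
    rw [Finset.mem_range] at hj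
    simp only [hookLength, hrow, hcol]
    split_ifs <;> first | contradiction | exact absurd trivial ‹_› | omega
  have h01 : hookLength (dPlus lam h) (0, 0 + 0 + 1) = b + c + 3 := by
    simp only [hookLength, hrow, hcol]
    split_ifs <;> first | contradiction | exact absurd trivial ‹_› | omega
  have h00 : hookLength (dPlus lam h) (0 + 0, 0) = 2 * (b + 2) := by
    simp only [hookLength, hrow, hcol]
    split_ifs <;> first | contradiction | exact absurd trivial ‹_› | omega
  have h10 : hookLength (dPlus lam h) (0 + (0 + 1), 0) = b + c + 3 := by
    simp only [hookLength, hrow, hcol]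
    split_ifs <;> first | contradiction | exact absurd trivial ‹_› | omega
  have h11 : hookLength (dPlus lam h) (1 + 0, 1) = 2 * (c + 1) := by
    simp only [hookLength, hrow, hcol]
    split_ifs <;> first | contradiction | exact absurd trivial ‹_› | omega
  rw [Finset.prod_congr rfl h2, Finset.prod_congr rfl h3, Finset.prod_congr rfl h4,
    Finset.prod_congr rfl h5, h01, h00, h10, h11, prod_range_sub_eq_factorial,
    prod_range_sub_eq_factorial]
  have e1 := prod_range_skip (b + 1) (c + 1) (by omega)
  have e2 := prod_range_skip b c (by omega)
  set X := ∏ j ∈ Finset.range (b + 1), (((b + 1 : ℕ) : ℤ) - j + if j < c + 1 then 1 else 0)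
  set Y := ∏ j ∈ Finset.range b, ((b : ℤ) - j + if j < c then 1 else 0)
  have e3 : (((b + 2)! : ℕ) : ℤ) = (b + 2) * (b + 1)! := by
    rw [Nat.factorial_succ]
    push_cast
    ring
  have e4 : (((c + 1)! : ℕ) : ℤ) = (c + 1) * c ! := by
    rw [Nat.factorial_succ]
    push_cast
    ring
  rw [show b + 1 + 1 = b + 2 by ring, e3] at e1
  rw [e3, e4]
  push_cast at e1 ⊢
  have e5 : (X * Y) * (b + 1 - c) ^ 2 = (b + 2) * ((b + 1)! : ℤ) * ((b + 1)! : ℤ) := by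
    linear_combination (Y * (b + 1 - c)) * e1 + ((b + 2) * ((b + 1)! : ℤ)) * e2
  linear_combination (4 * (b + c + 3 : ℤ) ^ 2 * (b + 2) * (c + 1) ^ 2 * (c ! : ℤ) ^ 2) * e5

theorem finrank_dPlus_one_row {lam : YoungDiagram} (h : IsStrictPartition lam) {N p : ℕ}
    (hp : 0 < p) (hpN : p ≤ N) (hl : ∀ i, lam.rowLen i = if i = 0 then p else 0) :
    (Module.finrank ℂ (schurFunctor (dPlus lam h) (Fin N → ℂ)) : ℚ) = legendreCoeff N p / 2 := by
  have h1 := congrArg (Int.cast : ℤ → ℚ) (finrank_schurFunctor_mul_prod_hookLength (dPlus lam h) N)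
  rw [prod_hookLength_dPlus_one_row h hp hl, contentProd_dPlus,
    prod_cells_eq lam 1 fun i hi => by rw [hl, if_neg (by omega)], Finset.prod_range_one, hl,
    if_pos rfl, prod_eq_legendreCoeff hpN] at h1
  push_cast at h1
  have h2 : ((p ! : ℚ) ^ 2) ≠ 0 := by positivity
  refine mul_right_cancel₀ h2 ?_
  linear_combination h1 / 2

theorem finrank_dMinus_one_row {lam : YoungDiagram} (h : IsStrictPartition lam) {m p : ℕ}
    (hp : 0 < p) (hpm : p ≤ m) (hl : ∀ i, lam.rowLen i = if i = 0 then p else 0) :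
    (Module.finrank ℂ (schurFunctor (dMinus lam h) (Fin (m + 1) → ℂ)) : ℚ) =
      legendreCoeff m p / 2 := by
  have h1 := congrArg (Int.cast : ℤ → ℚ)
    (finrank_schurFunctor_mul_prod_hookLength (dMinus lam h) (m + 1))
  rw [contentProd_dMinus, dMinus, prod_hookLength_transpose, prod_hookLength_dPlus_one_row h hp hl,
    prod_cells_eq lam 1 fun i hi => by rw [hl, if_neg (by omega)], Finset.prod_range_one, hl,
    if_pos rfl, prod_eq_legendreCoeff hpm] at h1
  push_cast at h1
  have h2 : ((p ! : ℚ) ^ 2) ≠ 0 := by positivity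
  refine mul_right_cancel₀ h2 ?_
  rw [dMinus]
  linear_combination h1 / 2

theorem finrank_dMinus_two_rows {lam : YoungDiagram} (h : IsStrictPartition lam) {m p q : ℕ}
    (hq : 0 < q) (hqp : q < p) (hpm : p ≤ m)
    (hl : ∀ i, lam.rowLen i = if i = 0 then p else if i = 1 then q else 0) :
    (Module.finrank ℂ (schurFunctor (dMinus lam h) (Fin (m + 1) → ℂ)) : ℚ) =
      legendreCoeff m p * legendreCoeff m q * ((p - q) ^ 2 / (p + q) ^ 2) / 4 := by
  have h1 := congrArg (Int.cast : ℤ → ℚ)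
    (finrank_schurFunctor_mul_prod_hookLength (dMinus lam h) (m + 1))
  have h2 := congrArg (Int.cast : ℤ → ℚ) (prod_hookLength_dPlus_two_rows h hq hqp hl)
  rw [contentProd_dMinus, dMinus, prod_hookLength_transpose, prod_cells_eq lam 2 fun i hi => by
    rw [hl, if_neg (by omega), if_neg (by omega)], Finset.prod_range_succ, Finset.prod_range_one,
    hl, hl, if_pos rfl, if_neg one_ne_zero, if_pos rfl, prod_eq_legendreCoeff hpm,
    prod_eq_legendreCoeff (by omega)] at h1
  rw [dMinus]
  set D := Module.finrank ℂ (schurFunctor (dPlus lam h).transpose (Fin (m + 1) → ℂ))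
  set H := ∏ x ∈ (dPlus lam h).cells, hookLength (dPlus lam h) x
  push_cast at h1 h2
  have e1 : (p ! : ℚ) ≠ 0 := by positivity
  have e2 : (q ! : ℚ) ≠ 0 := by positivity
  have e3 : (p : ℚ) + q ≠ 0 := by positivity
  have e4 : ((p ! : ℚ) ^ 2 * q ! ^ 2) ≠ 0 := by positivity
  rw [mul_div_assoc', div_div, eq_div_iff (by positivity)]
  refine mul_right_cancel₀ e4 ?_
  linear_combination ((p : ℚ) - q) ^ 2 * h1 - (D : ℚ) * h2

/-! ### Dimensions for hooks -/

section Hook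

variable {μ : YoungDiagram} {a b : ℕ}

theorem colLen_of_hook (hl : ∀ i, μ.rowLen i = if i = 0 then a + 1 else if i ≤ b then 1 else 0)
    (j : ℕ) : μ.colLen j = if j = 0 then b + 1 else if j ≤ a then 1 else 0 := by
  refine colLen_eq_of_forall fun i => ?_
  rw [YoungDiagram.mem_iff_lt_rowLen, hl]
  split_ifs <;> omega

theorem prod_hook (hl : ∀ i, μ.rowLen i = if i = 0 then a + 1 else if i ≤ b then 1 else 0)
    (g : ℕ × ℕ → ℤ) :
    ∏ x ∈ μ.cells, g x =
      g (0, 0) * (∏ j ∈ Finset.range a, g (0, j + 1)) * ∏ i ∈ Finset.range b, g (i + 1, 0) := by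
  rw [prod_cells_eq μ (b + 1) fun i hi => by rw [hl, if_neg (by omega), if_neg (by omega)],
    Finset.prod_range_succ', hl, if_pos rfl, Finset.prod_range_succ']
  have h : ∀ i ∈ Finset.range b, ∏ j ∈ Finset.range (μ.rowLen (i + 1)), g (i + 1, j) =
      g (i + 1, 0) := by
    intro i hi
    rw [Finset.mem_range] at hi
    rw [hl, if_neg (by omega), if_pos (by omega), Finset.prod_range_one]
  rw [Finset.prod_congr rfl h]
  ring

theorem finrank_hook (hl : ∀ i, μ.rowLen i = if i = 0 then a + 1 else if i ≤ b then 1 else 0)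
    (n : ℕ) :
    (Module.finrank ℂ (schurFunctor μ (Fin (n + 1) → ℂ)) : ℚ) * ((a + b + 1) * a ! * b !) =
      (n + 1) * (∏ j ∈ Finset.range a, ((n : ℚ) + 2 + j)) *
        ∏ i ∈ Finset.range b, ((n : ℚ) - i) := by
  have h1 := finrank_schurFunctor_mul_prod_hookLength μ (n + 1)
  rw [contentProd, prod_hook hl, prod_hook hl] at h1
  have h2 : ∀ j ∈ Finset.range a, hookLength μ (0, j + 1) = (a : ℤ) - j := by
    intro j hj
    rw [Finset.mem_range] at hj
    simp only [hookLength, hl, colLen_of_hook hl]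
    split_ifs <;> first | contradiction | exact absurd trivial ‹_› | omega
  have h3 : ∀ i ∈ Finset.range b, hookLength μ (i + 1, 0) = (b : ℤ) - i := by
    intro i hi
    rw [Finset.mem_range] at hi
    simp only [hookLength, hl, colLen_of_hook hl]
    split_ifs <;> first | contradiction | exact absurd trivial ‹_› | omega
  have h4 : hookLength μ (0, 0) = a + b + 1 := by
    simp only [hookLength, hl, colLen_of_hook hl]
    split_ifs <;> first | contradiction | exact absurd trivial ‹_› | omega
  rw [Finset.prod_congr rfl h2, Finset.prod_congr rfl h3, h4, prod_range_sub_eq_factorial,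
    prod_range_sub_eq_factorial] at h1
  have h5 := congrArg (Int.cast : ℤ → ℚ) h1
  push_cast at h5
  rw [h5]
  congr 1
  · congr 1
    · ring
    · exact Finset.prod_congr rfl fun j _ => by ring
  · exact Finset.prod_congr rfl fun j _ => by ring

theorem finrank_hook_mul_finrank_transpose
    (hl : ∀ i, μ.rowLen i = if i = 0 then a + 1 else if i ≤ b then 1 else 0) {n : ℕ}
    (ha : a ≤ n) (hb : b ≤ n) :
    (Module.finrank ℂ (schurFunctor μ (Fin (n + 1) → ℂ)) : ℚ) *
        Module.finrank ℂ (schurFunctor μ.transpose (Fin (n + 1) → ℂ)) =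
      hookCoeff n a * hookCoeff n b * (((n : ℚ) + 1) ^ 2 / (a + 1 + b) ^ 2) := by
  have h1 := finrank_hook hl n
  have h2 := finrank_hook (μ := μ.transpose) (a := b) (b := a) (fun i => by
    rw [YoungDiagram.rowLen_transpose, colLen_of_hook hl]) n
  have h3 := prod_eq_hookCoeff ha
  have h4 := prod_eq_hookCoeff hb
  rw [Finset.prod_mul_distrib] at h3 h4
  have e1 : ((a ! : ℚ) * b !) ^ 2 ≠ 0 := by positivity
  have e2 : ((a : ℚ) + 1 + b) ^ 2 ≠ 0 := by positivity
  rw [mul_div_assoc', eq_div_iff e2]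
  refine mul_right_cancel₀ e1 ?_
  set A := ∏ j ∈ Finset.range a, ((n : ℚ) + 2 + j)
  set A' := ∏ j ∈ Finset.range a, ((n : ℚ) - j)
  set B := ∏ j ∈ Finset.range b, ((n : ℚ) + 2 + j)
  set B' := ∏ j ∈ Finset.range b, ((n : ℚ) - j)
  set X := (Module.finrank ℂ (schurFunctor μ (Fin (n + 1) → ℂ)) : ℚ)
  set Y := (Module.finrank ℂ (schurFunctor μ.transpose (Fin (n + 1) → ℂ)) : ℚ)
  calc X * Y * (a + 1 + b) ^ 2 * (a ! * b !) ^ 2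
      = (X * ((a + b + 1) * a ! * b !)) * (Y * ((b + a + 1) * b ! * a !)) := by ring
    _ = ((n + 1) * A * B') * ((n + 1) * B * A') := by rw [h1, h2]
    _ = (n + 1) ^ 2 * (A * A') * (B * B') := by ring
    _ = _ := by rw [h3, h4]; ring

end Hook

/-! ### Diagrams in the intervals -/

theorem eq_of_rowLen_eq {μ ν : YoungDiagram} (h : ∀ i, μ.rowLen i = ν.rowLen i) : μ = ν := by
  refine YoungDiagram.ext (Finset.ext ?_)
  rintro ⟨i, j⟩
  rw [YoungDiagram.mem_cells, YoungDiagram.mem_cells, YoungDiagram.mem_iff_lt_rowLen,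
    YoungDiagram.mem_iff_lt_rowLen, h]

/-- The Young diagram with rows of length `f i` for `i < l`. -/
def ofRowLenFun (f : ℕ → ℕ) (l : ℕ) (hf : ∀ i j, i ≤ j → f j ≤ f i) : YoungDiagram where
  cells := (Finset.range l ×ˢ Finset.range (f 0)).filter fun x => x.2 < f x.1
  isLowerSet := by
    rintro ⟨i', j'⟩ ⟨i, j⟩ ⟨hi, hj⟩ h
    simp only [Finset.coe_filter, Finset.mem_product, Finset.mem_range, Set.mem_ofPred_eq] at h ⊢
    simp only at hi hj
    have h1 := hf i i' hi
    have h2 := hf 0 i (Nat.zero_le i)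
    omega

theorem rowLen_ofRowLenFun (f : ℕ → ℕ) (l : ℕ) (hf : ∀ i j, i ≤ j → f j ≤ f i)
    (hl : ∀ i, l ≤ i → f i = 0) (i : ℕ) : (ofRowLenFun f l hf).rowLen i = f i := by
  refine rowLen_eq_of_forall fun j => ?_
  rw [← YoungDiagram.mem_cells, ofRowLenFun]
  simp only [Finset.mem_filter, Finset.mem_product, Finset.mem_range]
  refine ⟨fun h => h.2, fun h => ⟨⟨?_, ?_⟩, h⟩⟩
  · by_contra hi
    rw [hl i (by omega)] at h
    omega
  · have := hf 0 i (Nat.zero_le i)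
    omega

theorem le_iff_rowLen_le {μ ν : YoungDiagram} : μ ≤ ν ↔ ∀ i, μ.rowLen i ≤ ν.rowLen i := by
  constructor
  · intro h i
    by_contra hi
    push Not at hi
    have h1 : (i, ν.rowLen i) ∈ μ := YoungDiagram.mem_iff_lt_rowLen.2 hi
    have h2 := YoungDiagram.mem_iff_lt_rowLen.1 (h h1)
    omega
  · rintro h ⟨i, j⟩ hx
    have h1 := YoungDiagram.mem_iff_lt_rowLen.1 hx
    exact YoungDiagram.mem_iff_lt_rowLen.2 (h1.trans_le (h i))

theorem card_eq_sum_rowLen (μ : YoungDiagram) (l : ℕ) (hl : ∀ i, l ≤ i → μ.rowLen i = 0) :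
    μ.card = ∑ i ∈ Finset.range l, μ.rowLen i := by
  have h := sum_cells_eq μ l hl fun _ => 1
  simpa using h

theorem rowLen_botPartition (i : ℕ) : botPartition.rowLen i = if i = 0 then 1 else 0 := by
  refine rowLen_eq_of_forall fun j => ?_
  rw [botPartition, YoungDiagram.mem_ofRowLens]
  rcases i with _ | i <;> simp

theorem rowLen_topReal (n i : ℕ) : (topReal n).rowLen i = if i = 0 then n + 1 else 0 := by
  refine rowLen_eq_of_forall fun j => ?_
  rw [topReal, YoungDiagram.mem_ofRowLens]
  rcases i with _ | i <;> simp

theorem rowLen_topComplex (n i : ℕ) :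
    (topComplex n).rowLen i = if i = 0 then n + 1 else if i ≤ n then 1 else 0 := by
  refine rowLen_eq_of_forall fun j => ?_
  rw [topComplex, YoungDiagram.mem_ofRowLens]
  rcases i with _ | i
  · simp
  · simp
    split_ifs with h
    · simp; omega
    · simp; omega

theorem rowLen_topQuaternion (n i : ℕ) :
    (topQuaternion n).rowLen i = if i = 0 then 2 * n + 1 else if i = 1 then 2 * n else 0 := by
  refine rowLen_eq_of_forall fun j => ?_
  rw [topQuaternion, YoungDiagram.mem_ofRowLens]
  rcases i with _ | _ | i <;> simp

theorem botPartition_le_iff {μ : YoungDiagram} : botPartition ≤ μ ↔ 0 < μ.rowLen 0 := by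
  rw [le_iff_rowLen_le]
  constructor
  · intro h
    have := h 0
    rw [rowLen_botPartition, if_pos rfl] at this
    omega
  · intro h i
    rw [rowLen_botPartition]
    split_ifs with hi
    · subst hi; omega
    · omega

/-- An alternating sum graded by a weight is a signed sum over all indices. -/
theorem sum_neg_one_pow_mul_of_bijective {ι : ℕ → Type} [∀ k, Fintype (ι k)] (S : Finset (ℕ × ℕ))
    (w : ℕ × ℕ → ℕ) (K : ℕ) (hw : ∀ x ∈ S, w x ≤ K) (sh : ∀ k, ι k → ℕ × ℕ)
    (hinj : ∀ k, Function.Injective (sh k))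
    (hrange : ∀ k x, (∃ lam, sh k lam = x) ↔ x ∈ S ∧ w x = k) (D : ℕ × ℕ → ℚ)
    (d : ∀ k, ι k → ℚ) (hd : ∀ k lam, d k lam = D (sh k lam)) :
    ∑ k ∈ Finset.range (K + 1), (-1 : ℚ) ^ k * ∑ lam, d k lam = ∑ x ∈ S, (-1) ^ w x * D x := by
  rw [← Finset.sum_fiberwise_of_maps_to (s := S) (t := Finset.range (K + 1)) (g := w)
    fun x hx => Finset.mem_range.2 (Nat.lt_succ_of_le (hw x hx))]
  refine Finset.sum_congr rfl fun k _ => ?_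
  rw [Finset.mul_sum]
  refine Finset.sum_bij (fun lam _ => sh k lam) ?_ ?_ ?_ ?_
  · intro lam _
    exact Finset.mem_filter.2 ((hrange k _).1 ⟨lam, rfl⟩)
  · intro _ _ _ _ h
    exact hinj k h
  · intro x hx
    obtain ⟨lam, h⟩ := (hrange k x).2 (Finset.mem_filter.1 hx)
    exact ⟨lam, Finset.mem_univ _, h⟩
  · intro lam _
    rw [hd, ((hrange k _).1 ⟨lam, rfl⟩).2]

theorem finite_of_injective_range {ι : Type} (S : Finset (ℕ × ℕ)) (sh : ι → ℕ × ℕ)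
    (hinj : Function.Injective sh) (h : ∀ lam, sh lam ∈ S) : Finite ι :=
  Finite.of_injective (fun lam => (⟨sh lam, h lam⟩ : S)) fun _ _ hxy =>
    hinj (congrArg Subtype.val hxy)

/-! ### The alternating sum over the reals -/

theorem rowLen_indexReal {n k : ℕ} (lam : IndexReal n k) (i : ℕ) :
    lam.1.1.rowLen i = if i = 0 then k else 0 := by
  have h1 := le_iff_rowLen_le.1 lam.2.2.1
  simp only [rowLen_topReal] at h1
  have h2 := card_eq_sum_rowLen lam.1.1 1 fun i hi => by
    have := h1 i
    rw [if_neg (by omega)] at this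
    omega
  rw [lam.2.2.2, Finset.sum_range_one] at h2
  have h3 := h1 i
  split_ifs with hi
  · rw [hi]
    exact h2.symm
  · rw [if_neg hi] at h3
    omega

/-- The only strict partition of `p + 1` in the interval is the row `(p + 1)`. -/
theorem sum_faceNumber_real (n : ℕ) :
    ∑ k ∈ Finset.range (n + 1), (-1 : ℚ) ^ k * (faceNumber .real n k : ℚ) =
      ∑ p ∈ Finset.range (n + 1), (-1) ^ p * (legendreCoeff (n + 1) (p + 1) / 2) := by
  have hinj : ∀ k, Function.Injective fun lam : IndexReal n (k + 1) =>
      (lam.1.1.rowLen 0 - 1, 0) := by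
    intro k x y _
    refine Subtype.ext (Subtype.ext (eq_of_rowLen_eq fun i => ?_))
    rw [rowLen_indexReal, rowLen_indexReal]
  have hle : ∀ k (lam : IndexReal n (k + 1)), k ≤ n := by
    intro k lam
    have h1 := le_iff_rowLen_le.1 lam.2.2.1 0
    rw [rowLen_indexReal, rowLen_topReal] at h1
    simpa using h1
  have hfin : ∀ k, Finite (IndexReal n (k + 1)) := fun k =>
    finite_of_injective_range (Finset.range (n + 1) ×ˢ {0}) _ (hinj k) fun lam => by
      have := hle k lam
      rw [rowLen_indexReal]
      simp
      omega
  let _ : ∀ k, Fintype (IndexReal n (k + 1)) := fun k => Fintype.ofFinite _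
  have h := sum_neg_one_pow_mul_of_bijective (Finset.range (n + 1) ×ˢ {0}) Prod.fst n
    (by rintro ⟨p, q⟩ hx; simp at hx ⊢; omega)
    (fun k (lam : IndexReal n (k + 1)) => (lam.1.1.rowLen 0 - 1, 0)) hinj
    (fun k x => ?_) (fun x => legendreCoeff (n + 1) (x.1 + 1) / 2)
    (fun k lam =>
      (Module.finrank ℂ (schurFunctor (dPlus lam.1.1 lam.1.2) (Fin (n + 1) → ℂ)) : ℚ))
    (fun k lam => ?_)
  · rw [Finset.sum_product] at h
    simp only [Finset.sum_singleton] at h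
    rw [← h]
    refine Finset.sum_congr rfl fun k _ => ?_
    rw [faceNumber, Module.finrank_directSum, Nat.cast_sum]
  · rcases x with ⟨p, q⟩
    constructor
    · rintro ⟨lam, hlam⟩
      have := hle k lam
      rw [rowLen_indexReal] at hlam
      simp at hlam ⊢
      omega
    · rintro ⟨hx, rfl⟩
      simp at hx
      obtain ⟨hp, rfl⟩ := hx
      have hr := rowLen_ofRowLenFun (fun i => if i = 0 then p + 1 else 0) 1
        (fun i j hij => by split_ifs <;> omega) (fun i hi => by rw [if_neg (by omega)])
      refine ⟨⟨⟨ofRowLenFun (fun i => if i = 0 then p + 1 else 0) 1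
        (fun i j hij => by split_ifs <;> omega), ?_⟩,
        ?_, ?_, ?_⟩, ?_⟩
      · intro i
        rw [hr, hr]
        rcases i with _ | i <;> simp
      · rw [botPartition_le_iff, hr]
        simp
      · rw [le_iff_rowLen_le]
        intro i
        rw [hr, rowLen_topReal]
        split_ifs <;> omega
      · rw [card_eq_sum_rowLen _ 1 fun i hi => by rw [hr, if_neg (by omega)],
          Finset.sum_range_one, hr, if_pos rfl]
      · simp only [hr]
        simp
  · have := hle k lam
    rw [finrank_dPlus_one_row lam.1.2 (Nat.succ_pos k) (by omega) (rowLen_indexReal lam),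
      rowLen_indexReal]
    simp

theorem altSum_faceNumber_real (n : ℕ) :
    ∑ k ∈ Finset.range (n + 1), (-1 : ℚ) ^ k * (faceNumber .real n k : ℚ) =
      (1 + (-1 : ℚ) ^ n) / 2 := by
  have h := sum_neg_one_pow_mul_legendreCoeff (n + 1)
  rw [Finset.sum_range_succ'] at h
  have h0 : legendreCoeff (n + 1) 0 = 1 := by simp [legendreCoeff]
  rw [h0] at h
  have h1 : ∑ p ∈ Finset.range (n + 1), (-1 : ℚ) ^ p * (legendreCoeff (n + 1) (p + 1) / 2) =
      -(∑ p ∈ Finset.range (n + 1), (-1 : ℚ) ^ (p + 1) * legendreCoeff (n + 1) (p + 1)) / 2 := by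
    rw [← Finset.sum_neg_distrib, Finset.sum_div]
    refine Finset.sum_congr rfl fun p _ => ?_
    ring
  rw [sum_faceNumber_real, h1]
  rw [pow_succ] at h
  linear_combination -h / 2

/-! ### The alternating sum over the complex numbers -/

theorem rowLen_indexComplex {n k : ℕ} (lam : IndexComplex n k) (i : ℕ) :
    lam.1.rowLen i = if i = 0 then lam.1.rowLen 0 - 1 + 1 else
      if i ≤ lam.1.colLen 0 - 1 then 1 else 0 := by
  have h0 := botPartition_le_iff.1 lam.2.1
  have h1 := le_iff_rowLen_le.1 lam.2.2.1 i
  have h2 : 0 < lam.1.rowLen i ↔ i < lam.1.colLen 0 := by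
    rw [← YoungDiagram.mem_iff_lt_rowLen, ← YoungDiagram.mem_iff_lt_colLen]
  rw [rowLen_topComplex] at h1
  by_cases hi : i = 0
  · rw [if_pos hi, hi]
    omega
  · rw [if_neg hi] at h1 ⊢
    split_ifs at h1 ⊢ <;> omega

theorem card_hook {μ : YoungDiagram} {a b : ℕ}
    (hl : ∀ i, μ.rowLen i = if i = 0 then a + 1 else if i ≤ b then 1 else 0) :
    μ.card = a + b + 1 := by
  rw [card_eq_sum_rowLen μ (b + 1) fun i hi => by rw [hl, if_neg (by omega), if_neg (by omega)],
    Finset.sum_range_succ', hl, if_pos rfl]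
  have h : ∀ i ∈ Finset.range b, μ.rowLen (i + 1) = 1 := by
    intro i hi
    rw [Finset.mem_range] at hi
    rw [hl, if_neg (by omega), if_pos (by omega)]
  rw [Finset.sum_congr rfl h]
  simp
  ring

theorem finrank_schurFunctor_tensor (μ : YoungDiagram) (n : ℕ) :
    (Module.finrank ℂ (schurFunctor μ (Fin (n + 1) → ℂ) ⊗[ℂ]
        schurFunctor μ.transpose (Fin (n + 1) → ℂ)) : ℚ) =
      (Module.finrank ℂ (schurFunctor μ (Fin (n + 1) → ℂ)) : ℚ) *
        Module.finrank ℂ (schurFunctor μ.transpose (Fin (n + 1) → ℂ)) := by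
  have h : ∀ ν : YoungDiagram, Module.Free ℂ (schurFunctor ν (Fin (n + 1) → ℂ)) := fun ν =>
    @Module.Free.of_divisionRing ℂ (schurFunctor ν (Fin (n + 1) → ℂ)) _ _ _
  have h1 := h μ
  have h2 := h μ.transpose
  rw [Module.finrank_tensorProduct, Nat.cast_mul]

/-- The partitions in the interval are the hooks `(p + 1, 1^q)` with `p, q ≤ n`. -/
theorem sum_faceNumber_complex (n : ℕ) :
    ∑ k ∈ Finset.range (2 * n + 1), (-1 : ℚ) ^ k * (faceNumber .complex n k : ℚ) =
      ∑ p ∈ Finset.range (n + 1), ∑ q ∈ Finset.range (n + 1), ((-1) ^ p * hookCoeff n p) *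
        ((-1) ^ q * hookCoeff n q) * (((n : ℚ) + 1) ^ 2 / (p + 1 + q) ^ 2) := by
  let sh : ∀ k, IndexComplex n (k + 1) → ℕ × ℕ := fun k lam =>
    (lam.1.rowLen 0 - 1, lam.1.colLen 0 - 1)
  have hinj : ∀ k, Function.Injective (sh k) := by
    intro k x y hxy
    have h1 : x.1.rowLen 0 - 1 = y.1.rowLen 0 - 1 := congrArg Prod.fst hxy
    have h2 : x.1.colLen 0 - 1 = y.1.colLen 0 - 1 := congrArg Prod.snd hxy
    refine Subtype.ext (eq_of_rowLen_eq fun i => ?_)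
    rw [rowLen_indexComplex x, rowLen_indexComplex y, h1, h2]
  have hle : ∀ k (lam : IndexComplex n (k + 1)), lam.1.rowLen 0 - 1 ≤ n ∧
      lam.1.colLen 0 - 1 ≤ n ∧ lam.1.rowLen 0 - 1 + (lam.1.colLen 0 - 1) = k := by
    intro k lam
    have h1 := le_iff_rowLen_le.1 lam.2.2.1
    have h2 := card_hook (rowLen_indexComplex lam)
    rw [lam.2.2.2] at h2
    have h3 := h1 0
    have h4 := h1 (lam.1.colLen 0 - 1)
    have h5 := rowLen_indexComplex lam (lam.1.colLen 0 - 1)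
    rw [rowLen_topComplex] at h3 h4
    refine ⟨by simp at h3; omega, ?_, by omega⟩
    split_ifs at h4 h5 <;> omega
  have hfin : ∀ k, Finite (IndexComplex n (k + 1)) := fun k =>
    finite_of_injective_range (Finset.range (n + 1) ×ˢ Finset.range (n + 1)) _ (hinj k)
      fun lam => by
        have := hle k lam
        simp only [sh, Finset.mem_product, Finset.mem_range]
        omega
  let _ : ∀ k, Fintype (IndexComplex n (k + 1)) := fun k => Fintype.ofFinite _
  have h := sum_neg_one_pow_mul_of_bijective (Finset.range (n + 1) ×ˢ Finset.range (n + 1))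
    (fun x => x.1 + x.2) (2 * n) (by rintro ⟨p, q⟩ hx; simp at hx ⊢; omega) sh hinj
    (fun k x => ?_)
    (fun x => hookCoeff n x.1 * hookCoeff n x.2 * (((n : ℚ) + 1) ^ 2 / (x.1 + 1 + x.2) ^ 2))
    (fun k lam => (Module.finrank ℂ (schurFunctor lam.1 (Fin (n + 1) → ℂ)) : ℚ) *
      Module.finrank ℂ (schurFunctor lam.1.transpose (Fin (n + 1) → ℂ)))
    (fun k lam => ?_)
  · rw [Finset.sum_product] at h
    have h1 : ∀ k ∈ Finset.range (2 * n + 1), (-1 : ℚ) ^ k * (faceNumber .complex n k : ℚ) =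
        (-1 : ℚ) ^ k * ∑ lam : IndexComplex n (k + 1),
          (Module.finrank ℂ (schurFunctor lam.1 (Fin (n + 1) → ℂ)) : ℚ) *
            Module.finrank ℂ (schurFunctor lam.1.transpose (Fin (n + 1) → ℂ)) := by
      intro k _
      rw [faceNumber, Module.finrank_directSum, Nat.cast_sum]
      refine congrArg _ (Finset.sum_congr rfl fun lam _ => ?_)
      exact finrank_schurFunctor_tensor lam.1 n
    rw [Finset.sum_congr rfl h1, h]
    refine Finset.sum_congr rfl fun p _ => Finset.sum_congr rfl fun q _ => ?_
    rw [pow_add]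
    ring
  · rcases x with ⟨p, q⟩
    constructor
    · rintro ⟨lam, hlam⟩
      have := hle k lam
      simp only [sh, Prod.mk.injEq] at hlam
      simp
      omega
    · rintro ⟨hx, rfl⟩
      simp at hx
      have hr := rowLen_ofRowLenFun (fun i => if i = 0 then p + 1 else if i ≤ q then 1 else 0)
        (q + 1) (fun i j hij => by split_ifs <;> omega)
        (fun i hi => by rw [if_neg (by omega), if_neg (by omega)])
      refine ⟨⟨ofRowLenFun (fun i => if i = 0 then p + 1 else if i ≤ q then 1 else 0)
        (q + 1) (fun i j hij => by split_ifs <;> omega), ?_, ?_, ?_⟩, ?_⟩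
      · rw [botPartition_le_iff, hr]
        simp
      · rw [le_iff_rowLen_le]
        intro i
        rw [hr, rowLen_topComplex]
        split_ifs <;> omega
      · rw [card_hook hr]
      · simp only [sh, hr, colLen_of_hook hr]
        simp
  · have := hle k lam
    exact finrank_hook_mul_finrank_transpose (rowLen_indexComplex lam) (by omega) (by omega)

/-! ### The alternating sum over the quaternions -/

theorem rowLen_indexQuaternion {n k : ℕ} (lam : IndexQuaternion n k) (i : ℕ) :
    lam.1.1.rowLen i = if i = 0 then lam.1.1.rowLen 0 else
      if i = 1 then lam.1.1.rowLen 1 else 0 := by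
  have h1 := le_iff_rowLen_le.1 lam.2.2.1 i
  rw [rowLen_topQuaternion] at h1
  split_ifs at h1 ⊢ with h2 h3
  · rw [h2]
  · rw [h3]
  · omega

theorem indexQuaternion_bounds {n k : ℕ} (lam : IndexQuaternion n k) :
    lam.1.1.rowLen 0 ≤ 2 * n + 1 ∧ lam.1.1.rowLen 1 < lam.1.1.rowLen 0 ∧
      lam.1.1.rowLen 0 + lam.1.1.rowLen 1 = k := by
  have h0 := botPartition_le_iff.1 lam.2.1
  have h1 := le_iff_rowLen_le.1 lam.2.2.1 0
  rw [rowLen_topQuaternion, if_pos rfl] at h1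
  have h2 := card_eq_sum_rowLen lam.1.1 2 fun i hi => by
    rw [rowLen_indexQuaternion, if_neg (by omega), if_neg (by omega)]
  rw [lam.2.2.2, Finset.sum_range_succ, Finset.sum_range_one] at h2
  exact ⟨h1, lam.1.2 0 h0, h2.symm⟩

/-- The dimension of `S_{d₋(p + 1, q)}` on `ℂ^{m+1}`, for `x = (p, q)`. The case `q = 0` is
separate: the general expression would be too small by a factor of two. -/
def quaternionDim (m : ℕ) (x : ℕ × ℕ) : ℚ :=
  if x.2 = 0 then legendreCoeff m (x.1 + 1) / 2
  else legendreCoeff m (x.1 + 1) * legendreCoeff m x.2 *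
    (((x.1 : ℚ) + 1 - x.2) ^ 2 / (x.1 + 1 + x.2) ^ 2) / 4

/-- The strict partitions in the interval are the `(p + 1, q)` with `q ≤ p ≤ 2n`. -/
theorem sum_faceNumber_quaternion (n : ℕ) :
    ∑ k ∈ Finset.range (4 * n + 1), (-1 : ℚ) ^ k * (faceNumber .quaternion n k : ℚ) =
      ∑ p ∈ Finset.range (2 * n + 1), ∑ q ∈ Finset.range (2 * n + 1),
        if q ≤ p then (-1) ^ (p + q) * quaternionDim (2 * n + 1) (p, q) else 0 := by
  let sh : ∀ k, IndexQuaternion n (k + 1) → ℕ × ℕ := fun k lam =>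
    (lam.1.1.rowLen 0 - 1, lam.1.1.rowLen 1)
  let S := (Finset.range (2 * n + 1) ×ˢ Finset.range (2 * n + 1)).filter fun x => x.2 ≤ x.1
  have hinj : ∀ k, Function.Injective (sh k) := by
    intro k x y hxy
    have h1 : x.1.1.rowLen 0 - 1 = y.1.1.rowLen 0 - 1 := congrArg Prod.fst hxy
    have h2 : x.1.1.rowLen 1 = y.1.1.rowLen 1 := congrArg Prod.snd hxy
    have h3 := indexQuaternion_bounds x
    have h4 := indexQuaternion_bounds y
    refine Subtype.ext (Subtype.ext (eq_of_rowLen_eq fun i => ?_))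
    rw [rowLen_indexQuaternion x, rowLen_indexQuaternion y, h2,
      show x.1.1.rowLen 0 = y.1.1.rowLen 0 by omega]
  have hfin : ∀ k, Finite (IndexQuaternion n (k + 1)) := fun k =>
    finite_of_injective_range S _ (hinj k) fun lam => by
      have := indexQuaternion_bounds lam
      simp only [sh, S, Finset.mem_filter, Finset.mem_product, Finset.mem_range]
      omega
  let _ : ∀ k, Fintype (IndexQuaternion n (k + 1)) := fun k => Fintype.ofFinite _
  have h := sum_neg_one_pow_mul_of_bijective S
    (fun x => x.1 + x.2) (4 * n) (by rintro ⟨p, q⟩ hx; simp [S] at hx ⊢; omega) sh hinj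
    (fun k x => ?_) (quaternionDim (2 * n + 1))
    (fun k lam =>
      (Module.finrank ℂ (schurFunctor (dMinus lam.1.1 lam.1.2) (Fin (2 * n + 2) → ℂ)) : ℚ))
    (fun k lam => ?_)
  · rw [Finset.sum_filter, Finset.sum_product] at h
    rw [← h]
    refine Finset.sum_congr rfl fun k _ => ?_
    rw [faceNumber, Module.finrank_directSum, Nat.cast_sum]
  · rcases x with ⟨p, q⟩
    constructor
    · rintro ⟨lam, hlam⟩
      have := indexQuaternion_bounds lam
      simp only [sh, Prod.mk.injEq] at hlam
      simp only [S, Finset.mem_filter, Finset.mem_product, Finset.mem_range]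
      omega
    · rintro ⟨hx, rfl⟩
      simp only [S, Finset.mem_filter, Finset.mem_product, Finset.mem_range] at hx
      have hr := rowLen_ofRowLenFun (fun i => if i = 0 then p + 1 else if i = 1 then q else 0)
        2 (fun i j hij => by split_ifs <;> omega)
        (fun i hi => by rw [if_neg (by omega), if_neg (by omega)])
      refine ⟨⟨⟨ofRowLenFun (fun i => if i = 0 then p + 1 else if i = 1 then q else 0)
        2 (fun i j hij => by split_ifs <;> omega), ?_⟩, ?_, ?_, ?_⟩, ?_⟩
      · intro i
        rw [hr, hr]
        rcases i with _ | _ | i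
        · simp
          omega
        · simp
        · simp
      · rw [botPartition_le_iff, hr]
        simp
      · rw [le_iff_rowLen_le]
        intro i
        rw [hr, rowLen_topQuaternion]
        split_ifs <;> omega
      · rw [card_eq_sum_rowLen _ 2 fun i hi => by rw [hr, if_neg (by omega), if_neg (by omega)],
          Finset.sum_range_succ, Finset.sum_range_one, hr, hr]
        simp
        omega
      · simp only [sh, hr]
        simp
  · obtain ⟨h1, h2, h3⟩ := indexQuaternion_bounds lam
    have hl := rowLen_indexQuaternion lam
    obtain ⟨p, hp⟩ : ∃ p, lam.1.1.rowLen 0 = p + 1 := ⟨lam.1.1.rowLen 0 - 1, by omega⟩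
    simp only [sh, quaternionDim]
    rw [hp] at h1 h2 h3 hl ⊢
    split_ifs with hq
    · refine finrank_dMinus_one_row (m := 2 * n + 1) lam.1.2 (Nat.succ_pos p) h1 fun i => ?_
      rw [hl, hq]
      split_ifs <;> rfl
    · have := finrank_dMinus_two_rows (m := 2 * n + 1) lam.1.2 (Nat.pos_of_ne_zero hq) h2 h1 hl
      rw [Nat.cast_succ] at this
      exact this

theorem sum_if_le_eq_half {G : ℕ → ℕ → ℚ} (hsymm : ∀ p q, G p q = G q p) (hdiag : ∀ p, G p p = 0)
    (m : ℕ) :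
    ∑ p ∈ Finset.range m, ∑ q ∈ Finset.range m, (if q < p then G p q else 0) =
      (∑ p ∈ Finset.range m, ∑ q ∈ Finset.range m, G p q) / 2 := by
  have h1 : ∑ p ∈ Finset.range m, ∑ q ∈ Finset.range m, G p q =
      ∑ p ∈ Finset.range m, ∑ q ∈ Finset.range m, (if q < p then G p q else 0) +
        ∑ p ∈ Finset.range m, ∑ q ∈ Finset.range m, (if p < q then G q p else 0) := by
    simp only [← Finset.sum_add_distrib]
    refine Finset.sum_congr rfl fun p _ => Finset.sum_congr rfl fun q _ => ?_
    rcases lt_trichotomy p q with h | rfl | h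
    · rw [if_neg (by omega), if_pos h, zero_add, hsymm]
    · rw [hdiag]; simp
    · rw [if_pos h, if_neg (by omega), add_zero]
  rw [Finset.sum_comm (f := fun p q => if p < q then G q p else 0)] at h1
  linarith

theorem altSum_faceNumber_quaternion (n : ℕ) :
    ∑ k ∈ Finset.range (4 * n + 1), (-1 : ℚ) ^ k * (faceNumber .quaternion n k : ℚ) = n + 1 := by
  rw [sum_faceNumber_quaternion]
  obtain ⟨m, hm⟩ : ∃ m, m = 2 * n + 1 := ⟨_, rfl⟩
  rw [← hm]
  set w : ℕ → ℚ := fun p => (-1) ^ (p + 1) * legendreCoeff m (p + 1) with hw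
  have hsum : ∑ p ∈ Finset.range m, w p = -2 := by
    have h := sum_neg_one_pow_mul_legendreCoeff m
    rw [Finset.sum_range_succ', Odd.neg_one_pow ⟨n, hm⟩] at h
    have h0 : legendreCoeff m 0 = 1 := by simp [legendreCoeff]
    rw [h0] at h
    simp only [hw]
    linarith
  -- the terms with `q = 0` are split off
  have hsplit : ∀ p ∈ Finset.range m, ∑ q ∈ Finset.range m,
      (if q ≤ p then (-1) ^ (p + q) * quaternionDim m (p, q) else 0) =
      (∑ q ∈ Finset.range m, if q < p then
        -(w p * w q * (((p : ℚ) - q) ^ 2 / (p + 1 + (q + 1)) ^ 2)) / 4 else 0) - w p / 2 := by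
    intro p hp
    rw [Finset.mem_range] at hp
    have h1 : ∑ q ∈ Finset.range m,
        (if q ≤ p then (-1) ^ (p + q) * quaternionDim m (p, q) else 0) =
        ∑ q ∈ Finset.range (m + 1),
          if q ≤ p then (-1) ^ (p + q) * quaternionDim m (p, q) else 0 := by
      rw [Finset.sum_range_succ, if_neg (by omega), add_zero]
    rw [h1, Finset.sum_range_succ', sub_eq_add_neg]
    congr 1
    · refine Finset.sum_congr rfl fun q _ => ?_
      refine if_congr (by omega) ?_ rfl
      rw [quaternionDim, if_neg (by simp)]
      simp only [hw]
      push_cast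
      ring
    · rw [if_pos (Nat.zero_le p), quaternionDim, if_pos rfl]
      simp only [hw]
      ring
  rw [Finset.sum_congr rfl hsplit, Finset.sum_sub_distrib, ← Finset.sum_div, hsum,
    sum_if_le_eq_half (G := fun p q => -(w p * w q * (((p : ℚ) - q) ^ 2 /
      (p + 1 + (q + 1)) ^ 2)) / 4) (fun p q => by ring) (fun p => by simp)]
  -- `(p - q)² = (p + q)² - 4 p q`
  have h2 : ∀ p q : ℕ, -(w p * w q * (((p : ℚ) - q) ^ 2 / (p + 1 + (q + 1)) ^ 2)) / 4 =
      w p * w q * (((p : ℚ) + 1) * (q + 1) / (p + 1 + (q + 1)) ^ 2) - w p * w q / 4 := by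
    intro p q
    have h3 : (p : ℚ) + 1 + (q + 1) ≠ 0 := by positivity
    field_simp
    ring
  have h4 := sum_sum_legendreCoeff m
  simp only [h2, Finset.sum_sub_distrib]
  rw [h4]
  have h5 : ∑ p ∈ Finset.range m, ∑ q ∈ Finset.range m, w p * w q / 4 = 1 := by
    simp only [← Finset.sum_div, ← Finset.mul_sum, ← Finset.sum_mul, hsum]
    norm_num
  rw [h5, hm]
  push_cast
  ring

theorem mainTheorem8 (A : HurwitzAlgebra) (n : ℕ) (hn : 2 ≤ n) :
    ∑ k ∈ Finset.range (n * A.dim + 1), (-1 : ℚ) ^ k * (faceNumber A n k : ℚ) =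
      if A.dim = 1 then (1 + (-1 : ℚ) ^ n) / 2 else (n : ℚ) + 1 := by
  cases A with
  | real =>
    rw [HurwitzAlgebra.dim, mul_one, if_pos rfl]
    exact altSum_faceNumber_real n
  | complex =>
    rw [HurwitzAlgebra.dim, mul_comm n, if_neg (by norm_num), sum_faceNumber_complex]
    exact sum_sum_hookCoeff n
  | quaternion =>
    rw [HurwitzAlgebra.dim, mul_comm n, if_neg (by norm_num)]
    exact altSum_faceNumber_quaternion n
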